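/- **Setting.** Let $\mathcal X,\mathcal U,\mathcal A$ be finite sets ($\mathcal U,\mathcal A\neq\emptyset$), $f:\mathcal X\times\mathcal U\times\mathcal A\to\mathcal X$ deterministic dynamics, $h:\mathcal X\to\mathbb R$ a constraint function, $r:\mathcal X\times\mathcal U\times\mathcal A\to\mathbb R$ a reward, $\gamma\in[0,1)$ and $\gamma_h\in(0,1)$ discount factors. Policies are stationary maps $\pi:\mathcal X\to\Delta(\mathcal U)$ (protagonist) and $\mu:\mathcal X\to\Delta(\mathcal A)$ (adversary). *Safety values.* For a protagonist policy $\pi$ let $Q_{\mathrm{safe}}^{\pi}(x,u,a)=\min_\mu\min_\tau\min_{t\ge0}h(x_t)$, where $\tau=(x_t,u_t,a_t)_{t\ge 0}$ ranges over the trajectories with $(x_0,u_0,a_0)=(x,u,a)$, $x_{t+1}=f(x_t,u_t,a_t)$ and, for $t\ge1$, $\pi(u_t|x_t)>0$, $\mu(a_t|x_t)>0$. Let $Q_{\mathrm{safe}}^{*}=\max_\pi Q_{\mathrm{safe}}^{\pi}$ and $V_h^\pi(x)=\max_u\min_aQ_{\mathrm{safe}}^{\pi}(x,u,a)$. For $Q:\mathcal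 X\times\mathcal U\times\mathcal A\to\mathbb R$ put $S(Q)=\{x:\max_u\min_aQ(x,u,a)\ge0\}$, $U_Q(x)=\{u:\min_aQ(x,u,a)\ge0\}$, and let $\Pi(Q)$ be the set of protagonist policies with $\pi(u|x)=0$ whenever $x\in S(Q)$, $u\notin U_Q(x)$. Assume that the maximal robust invariant set $S(Q_{\mathrm{safe}}^{*})$ is nonempty. With $x'=f(x,u,a)$ and $\sigma:\mathcal X\to\mathcal U$ a deterministic policy, let $$[T_h^{\sigma}Q](x,u,a)=(1-\gamma_h)h(x)+\gamma_h\min\{h(x),\min_{a'}Q(x',\sigma(x'),a')\},$$ $$[T_hQ](x,u,a)=(1-\gamma_h)h(x)+\gamma_h\min\{h(x),\max_{u'}\min_{a'}Q(x',u',a')\}.$$ *Performance values.* Let $Q^{\pi,\mu}(x,u,a)=\mathbb E\sum_{t\ge0}\gamma^tr(x_t,u_t,a_t)$ for the chain started at $(x,u,a)$, with $x_{t+1}=f(x_t,u_t,a_t)$ and, for $t\ge1$, independent draws $u_t\sim\pi(\cdot|x_t)$, $a_t\sim\mu(\cdot|x_t)$. Let $Q^\pi=\min_\mu Q^{\pi,\mu}$,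 $V^\pi(x)=\min_a\sum_u\pi(u|x)Q^\pi(x,u,a)$ and $$[T^\pi Q](x,u,a)=r(x,u,a)+\gamma\min_{a'}\sum_{u'}\pi(u'|x')Q(x',u',a').$$ *Twofold problem.* Let $Q_h^*$ be the fixed point of $T_h$ and $S^*=S(Q_h^*)$. For a distribution $d$ of $x_0$ on $\mathcal X$, maximize over $\pi$ $$J_d(\pi)=\mathbb E_{x_0\sim d}\{V^\pi(x_0)\mathbb 1_{S^*}(x_0)+V_h^\pi(x_0)\mathbb 1_{\mathcal X\setminus S^*}(x_0)\}$$ subject to: along every trajectory with $d(x_0)>0$, $\pi(u_t|x_t)>0$, $x_{t+1}=f(x_t,u_t,a_t)$ ($t\ge0$) and arbitrary adversary actions $a_t$, one has $\min_aQ_h^*(x_t,u_t,a)\ge0$ whenever $x_t\in S^*$. *Dual policy iteration.* Fix $n\ge1$, an initial task policy $\pi_0$ and an initial deterministic safety policy $\sigma$. In each outer iteration: (i) repeat $n$ times: solve $T_h^{\sigma}Q_h^{\sigma}=Q_h^{\sigma}$, then replace $\sigma(x)$, for every $x$, by an element of $\arg\max_u\min_aQ_h^{\sigma}(x,u,a)$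 (in the first outer iteration this block of $n$ steps is repeated until $S(Q_h^{\sigma})\ne\emptyset$ for the current $\sigma$); (ii) solve $T^\pi Q=Q$ for the current task policy $\pi$; (iii) for $x\in S(Q_h^\sigma)$ replace $\pi(\cdot|x)$ by a maximizer of $\min_a\sum_u\rho(u)Q(x,u,a)$ over the distributions $\rho$ carried by $U_{Q_h^\sigma}(x)$; for $x\notin S(Q_h^\sigma)$ let $\pi(\cdot|x)$ be the point mass at $\sigma(x)$. Ties in $\arg\max$ are broken arbitrarily. Let $\sigma_k$ be the safety policy after $k$ safety improvements, and $\pi_m$ the task policy after $m$ outer iterations. **Theorem.** There is $\gamma_0<1$, depending only on $\mathcal X,\mathcal U,\mathcal A,f,h$, such that the following holds for all $\gamma_h\in(0,1)$, $r$, $\gamma\in[0,1)$, $n\ge1$ and all initial policies. 1. $T_h$ has a unique fixed point $Q_h^*$, the algorithm can be executed, and for every run $Q_h^{\sigma_k}\le Q_h^{\sigma_{k+1}}\le Q_h^*$ for all $k$, with $Q_h^{\sigma_k}=Q_h^*$ for all large $k$. Hence $S(Q_h^{\sigma_k})\subseteq S(Q_h^{\sigma_{k+1}})$ for all $k$ and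 $S(Q_h^{\sigma_k})=S^*$ for all large $k$. 2. If moreover $\gamma_h>\gamma_0$, then $S^*=S(Q_{\mathrm{safe}}^*)$ and $U_{Q_h^*}=U_{Q_{\mathrm{safe}}^*}$, and for every run: (a) for all large $m$, $\pi_m\in\Pi(Q_h^*)$, and outside $S^*$ the policy $\pi_m$ equals the current safety policy $\sigma$, for which $Q_h^\sigma=Q_h^*$; (b) for every $x\in S^*$, the maximum $\max_{\pi\in\Pi(Q_h^*)}V^\pi(x)$ exists and $V^{\pi_m}(x)$ converges to it as $m\to\infty$; (c) for all large $m$ and all $x\notin S^*$, $V_h^{\pi_m}(x)=\max_\pi V_h^\pi(x)$; (d) for every distribution $d$, the twofold problem has a solution, $\pi_m$ is feasible for all large $m$, $J_d(\pi_m)$ converges to the optimal value, and the distance from $\pi_m$ to the set of solutions tends to $0$. -/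

import Mathlib

open Filter Topology

namespace ConstrainedGame

/-- A stationary (stochastic) policy `S → Δ(B)`: `p x b` is the probability of choosing `b` at `x`.
Used both for the protagonist (`B = U`) and for the adversary (`B = A`). -/
abbrev Policy (S B : Type*) [Fintype B] := S → stdSimplex ℝ B

/-- Action-value functions. -/
abbrev ActionValue (X U A : Type*) := X → U → A → ℝ

section Definitions

variable {X U A : Type*} [Fintype U] [Fintype A]

/-! ### Undiscounted safety values

All maxima and minima below are over finite sets, or over families of numbers `h x` with `x`
in the finite state space, so that `⨆` and `⨅` are genuine suprema and infima. -/

/-- `τ = (x₀,u₀,a₀), (x₁,u₁,a₁), …` is a trajectory that starts from `(x,u,a)` and lies in the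
support of the trajectory distribution generated by `π` and `μ`: from time `1` on, every action
has positive probability. -/
def IsTrajectory (f : X → U → A → X) (π : Policy X U) (μ : Policy X A) (x : X) (u : U) (a : A)
    (τ : ℕ → X × U × A) : Prop :=
  τ 0 = (x, u, a) ∧
  ∀ t, (τ (t + 1)).1 = f (τ t).1 (τ t).2.1 (τ t).2.2 ∧
    0 < π (τ (t + 1)).1 (τ (t + 1)).2.1 ∧
    0 < μ (τ (t + 1)).1 (τ (t + 1)).2.2

/-- Safety value of a trajectory: the least constraint value along it. -/
noncomputable def trajSafety (h : X → ℝ) (τ : ℕ → X × U × A) : ℝ := ⨅ t, h (τ t).1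

/-- Safety value of a pair of policies: the worst trajectory in the support. -/
noncomputable def pairSafety (f : X → U → A → X) (h : X → ℝ) (π : Policy X U) (μ : Policy X A) :
    ActionValue X U A :=
  fun x u a => ⨅ τ : {τ : ℕ → X × U × A // IsTrajectory f π μ x u a τ}, trajSafety h τ.1

/-- Safety value of a protagonist policy: the worst adversary policy. -/
noncomputable def policySafety (f : X → U → A → X) (h : X → ℝ) (π : Policy X U) :
    ActionValue X U A :=
  fun x u a => ⨅ μ : Policy X A, pairSafety f h π μ x u a

/-- Optimal safety value: the best protagonist policy. -/
noncomputable def optimalSafety (f : X → U → A → X) (h : X → ℝ) : ActionValue X U A :=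
  fun x u a => ⨆ π : Policy X U, policySafety f h π x u a

/-- Safety state-value `max_u min_a` of the safety value of a policy. -/
noncomputable def stateSafety (f : X → U → A → X) (h : X → ℝ) (π : Policy X U) (x : X) : ℝ :=
  ⨆ u, ⨅ a, policySafety f h π x u a

/-! ### Robust invariant sets and invariant policies attached to a safety value function -/

/-- `{x | max_u min_a Q(x,u,a) ≥ 0}`. -/
def robustSet (Q : ActionValue X U A) : Set X := {x | 0 ≤ ⨆ u, ⨅ a, Q x u a}

/-- Admissible actions at `x`: `{u | min_a Q(x,u,a) ≥ 0}`. -/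
def admissible (Q : ActionValue X U A) (x : X) : Set U := {u | 0 ≤ ⨅ a, Q x u a}

/-- Policies that use only admissible actions at the states of `robustSet Q`. -/
def invariantPolicies (Q : ActionValue X U A) : Set (Policy X U) :=
  {π | ∀ x ∈ robustSet Q, ∀ u, u ∉ admissible Q x → π x u = 0}

/-! ### Discounted safety operators -/

/-- Safety self-consistency operator of a deterministic protagonist policy `σ`. -/
noncomputable def safetyPolicyOp (f : X → U → A → X) (h : X → ℝ) (γh : ℝ) (σ : X → U)
    (Q : ActionValue X U A) : ActionValue X U A :=
  fun x u a => (1 - γh) * h x + γh * min (h x) (⨅ a', Q (f x u a) (σ (f x u a)) a')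

/-- Safety Bellman operator. -/
noncomputable def safetyBellmanOp (f : X → U → A → X) (h : X → ℝ) (γh : ℝ)
    (Q : ActionValue X U A) : ActionValue X U A :=
  fun x u a => (1 - γh) * h x + γh * min (h x) (⨆ u', ⨅ a', Q (f x u a) u' a')

/-! ### Performance values -/

/-- One-step conditional expectation: `(x,u,a) ↦ E[g(x₁,u₁,a₁)]` for the controlled chain started
from `(x₀,u₀,a₀) = (x,u,a)`, where `x₁ = f(x,u,a)`, `u₁ ∼ π(·|x₁)` and `a₁ ∼ μ(·|x₁)` are drawn
independently. Its `t`-th iterate is `(x,u,a) ↦ E[g(x_t,u_t,a_t)]`. -/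
noncomputable def stepExpectation (f : X → U → A → X) (π : Policy X U) (μ : Policy X A)
    (g : ActionValue X U A) : ActionValue X U A :=
  fun x u a => ∑ u', π (f x u a) u' * ∑ a', μ (f x u a) a' * g (f x u a) u' a'

/-- Expected discounted total reward of a pair of policies, started from `(x,u,a)`. -/
noncomputable def pairValue (f : X → U → A → X) (r : ActionValue X U A) (γ : ℝ)
    (π : Policy X U) (μ : Policy X A) : ActionValue X U A :=
  fun x u a => ∑' t : ℕ, γ ^ t * ((stepExpectation f π μ)^[t] r) x u a

/-- Worst-case value of a protagonist policy over all adversary policies. -/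
noncomputable def policyValue (f : X → U → A → X) (r : ActionValue X U A) (γ : ℝ)
    (π : Policy X U) : ActionValue X U A :=
  fun x u a => ⨅ μ : Policy X A, pairValue f r γ π μ x u a

/-- Worst-case state value; the adversary does not observe the action drawn from `π(·|x)`. -/
noncomputable def stateValue (f : X → U → A → X) (r : ActionValue X U A) (γ : ℝ)
    (π : Policy X U) (x : X) : ℝ :=
  ⨅ a, ∑ u, π x u * policyValue f r γ π x u a

/-- Performance self-consistency operator of a protagonist policy. -/
noncomputable def performanceOp (f : X → U → A → X) (r : ActionValue X U A) (γ : ℝ)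
    (π : Policy X U) (Q : ActionValue X U A) : ActionValue X U A :=
  fun x u a => r x u a + γ * ⨅ a', ∑ u', π (f x u a) u' * Q (f x u a) u' a'

/-! ### The twofold constrained problem -/

/-- Constraint of the problem for initial distribution `d` and optimal safety value `Qs`: along every
trajectory generated by `π` from the support of `d`, whatever the adversary actions, each action
`u_t` used at a state `x_t` of the maximal robust invariant set has `min_a Qs(x_t,u_t,a) ≥ 0`. -/
def Feasible [Fintype X] (f : X → U → A → X) (d : stdSimplex ℝ X) (Qs : ActionValue X U A)
    (π : Policy X U) : Prop :=
  ∀ τ : ℕ → X × U × A, 0 < d (τ 0).1 →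
    (∀ t, (τ (t + 1)).1 = f (τ t).1 (τ t).2.1 (τ t).2.2) →
    (∀ t, 0 < π (τ t).1 (τ t).2.1) →
    ∀ t, (τ t).1 ∈ robustSet Qs → 0 ≤ ⨅ a, Qs (τ t).1 (τ t).2.1 a

/-- Twofold objective: expected worst-case reward inside the maximal robust invariant set, expected
safety value outside. -/
noncomputable def objective [Fintype X] (f : X → U → A → X) (h : X → ℝ) (r : ActionValue X U A)
    (γ : ℝ) (d : stdSimplex ℝ X) (Qs : ActionValue X U A) (π : Policy X U) : ℝ :=
  ∑ x, d x * ((robustSet Qs).indicator (stateValue f r γ π) x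
    + (robustSet Qs)ᶜ.indicator (stateSafety f h π) x)

/-- Solutions: feasible policies whose objective is maximal among all feasible policies. -/
def solutions [Fintype X] (f : X → U → A → X) (h : X → ℝ) (r : ActionValue X U A)
    (γ : ℝ) (d : stdSimplex ℝ X) (Qs : ActionValue X U A) : Set (Policy X U) :=
  {π | Feasible f d Qs π ∧
    ∀ π', Feasible f d Qs π' → objective f h r γ d Qs π' ≤ objective f h r γ d Qs π}

/-! ### Dual policy iteration -/

/-- `σ'(x) ∈ argmax_u min_a Qh(x,u,a)` for every state `x`. -/
def IsSafetyImprovement (Qh : ActionValue X U A) (σ' : X → U) : Prop :=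
  ∀ x u, ⨅ a, Qh x u a ≤ ⨅ a, Qh x (σ' x) a

/-- Task policy improvement, from the task value `Q` and from a safety policy `σ` with safety value
`Qh`. Inside `robustSet Qh`, the new distribution at `x` solves the matrix game
`max_ρ min_a ∑_u ρ(u) Q(x,u,a)` over the distributions `ρ` carried by the admissible actions;
outside, the safety policy is copied. -/
def IsTaskImprovement (Q Qh : ActionValue X U A) (σ : X → U) (π' : Policy X U) : Prop :=
  (∀ x ∈ robustSet Qh,
    (∀ u, u ∉ admissible Qh x → π' x u = 0) ∧
    ∀ ρ : stdSimplex ℝ U, (∀ u, u ∉ admissible Qh x → ρ u = 0) →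
      ⨅ a, ∑ u, ρ u * Q x u a ≤ ⨅ a, ∑ u, π' x u * Q x u a) ∧
  ∀ x, x ∉ robustSet Qh → π' x (σ x) = 1

/-- A run of dual policy iteration with `n` safety iterations per outer iteration, continued for all
outer iterations (stopping after `m` of them returns `π m`); ties in argmax are broken arbitrarily.

* `σ k` is the safety policy after `k` safety improvements and `Qh k` its evaluation.
* `π j` is the task policy after `j` outer iterations and `Q j` its evaluation.
* `K` is the number of times the block of `n` safety iterations is executed in the first outer
  iteration: it is repeated until the robust invariant set of the current safety policy is nonempty.
  Every later outer iteration executes one block, so that outer iteration number `j + 1` improves the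
  task policy with the safety policy `σ ((K + j) * n)`. -/
structure IsRun (f : X → U → A → X) (h : X → ℝ) (r : ActionValue X U A) (γh γ : ℝ) (n : ℕ)
    (π₀ : Policy X U) (σ₀ : X → U)
    (π : ℕ → Policy X U) (Q : ℕ → ActionValue X U A)
    (σ : ℕ → X → U) (Qh : ℕ → ActionValue X U A) (K : ℕ) : Prop where
  task_init : π 0 = π₀
  safety_init : σ 0 = σ₀
  safety_evaluation : ∀ k, safetyPolicyOp f h γh (σ k) (Qh k) = Qh k
  safety_improvement : ∀ k, IsSafetyImprovement (Qh k) (σ (k + 1))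
  first_pos : 1 ≤ K
  first_check : (robustSet (Qh (K * n))).Nonempty
  first_least : ∀ i, 1 ≤ i → i < K → robustSet (Qh (i * n)) = ∅
  task_evaluation : ∀ j, performanceOp f r γ (π j) (Q j) = Q j
  task_improvement : ∀ j,
    IsTaskImprovement (Q j) (Qh ((K + j) * n)) (σ ((K + j) * n)) (π (j + 1))

end Definitions

end ConstrainedGame

open ConstrainedGame

/-!
All Bellman operators here are monotone and shift constants by at most the factor `γ`, so that sub-
and supersolutions can be compared, also when the inequality holds only on a set of pairs that play
does not leave. Such an operator has a unique fixed point.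

**Safety.** Improving `σ` makes its value a subsolution of the next evaluation operator, hence
safety policy iteration is monotone; as there are finitely many deterministic policies, it becomes
stationary, and a stationary value solves the optimal equation. As `γh` increases to `1`, the fixed
points of `T_h` decrease to a fixed point of the undiscounted operator. From every triple of one of
its superlevel sets the protagonist can remain in that set. The levels that matter are `0` and the
finitely many values of `h`, hence the same is true of the discounted fixed point once `γh` exceeds
some `γ₀ < 1`. A policy that is admissible inside the robust set and copies a greedy safety policy
outside then never leaves these superlevel sets. Hence no policy has a larger safety value outside
the robust set, and the discounted value has the sign of the true one.

**Performance.** Inside the robust set, the run is eventually policy iteration for a Markov game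
with action constraints, in which the distance to the optimal value contracts by `γ` per step. A
policy that is feasible for the twofold problem is admissible wherever its own play from the support
of `d` passes, and comparison on that set of pairs bounds its value. Finally the space of policies
is compact, and the cluster points of the task policies are safe and solve the one-shot games given
by the optimal value: they are solutions, so the distance to the solutions tends to `0`.
-/

namespace ConstrainedGame

section FiniteExtrema

variable {ι Y : Type*}

lemma iInf_mem_of_finite [Nonempty ι] {s : Set ℝ} (hs : s.Finite) {p : ι → ℝ}
    (hp : ∀ i, p i ∈ s) : iInf p ∈ s :=
  have hps : Set.range p ⊆ s := Set.range_subset_iff.2 hp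
  hps ((Set.range_nonempty p).csInf_mem (hs.subset hps))

lemma iInf_le_of_mem_finite {s : Set ℝ} (hs : s.Finite) {p : ι → ℝ} (hp : ∀ i, p i ∈ s) (i : ι) :
    iInf p ≤ p i :=
  ciInf_le (hs.subset (Set.range_subset_iff.2 hp)).bddBelow i

variable [Finite ι] [Nonempty ι]

lemma le_iInf_iff_of_finite {p : ι → ℝ} {c : ℝ} : c ≤ iInf p ↔ ∀ i, c ≤ p i :=
  le_ciInf_iff (Finite.bddBelow_range p)

lemma le_iSup_iff_of_finite {p : ι → ℝ} {c : ℝ} : c ≤ iSup p ↔ ∃ i, c ≤ p i := by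
  refine ⟨fun hc => ?_, fun ⟨i, hi⟩ => hi.trans (Finite.le_ciSup p i)⟩
  obtain ⟨i, hi⟩ := exists_eq_ciSup_of_finite (f := p)
  exact ⟨i, hc.trans_eq hi.symm⟩

lemma iInf_le_iInf_add {p q : ι → ℝ} {c : ℝ} (hpq : ∀ i, p i ≤ q i + c) :
    iInf p ≤ iInf q + c := by
  rw [← sub_le_iff_le_add]
  exact le_ciInf fun i => sub_le_iff_le_add.2 ((Finite.ciInf_le p i).trans (hpq i))

lemma iSup_le_iSup_add {p q : ι → ℝ} {c : ℝ} (hpq : ∀ i, p i ≤ q i + c) :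
    iSup p ≤ iSup q + c :=
  ciSup_le fun i => (hpq i).trans (add_le_add_left (Finite.le_ciSup q i) c)

variable [TopologicalSpace Y] {g : ι → Y → ℝ}

lemma continuous_iInf_of_finite (hg : ∀ i, Continuous (g i)) : Continuous fun y => ⨅ i, g i y := by
  cases nonempty_fintype ι
  simp only [← Finset.inf'_univ_eq_ciInf]
  exact Continuous.finset_inf'_apply _ fun i _ => hg i

lemma continuous_iSup_of_finite (hg : ∀ i, Continuous (g i)) : Continuous fun y => ⨆ i, g i y := by
  cases nonempty_fintype ι
  simp only [← Finset.sup'_univ_eq_ciSup]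
  exact Continuous.finset_sup'_apply _ fun i _ => hg i

end FiniteExtrema

section Discounting

lemma le_of_forall_le_add_mul {ι : Type*} [Finite ι] {γ : ℝ} (hγ : γ < 1) {s : Set ι} {p q : ι → ℝ}
    (H : ∀ c, 0 ≤ c → (∀ i ∈ s, p i ≤ q i + c) → ∀ i ∈ s, p i ≤ q i + γ * c) :
    ∀ i ∈ s, p i ≤ q i := by
  intro i hi
  by_contra! hlt
  obtain ⟨k, hk, hmax⟩ := s.exists_max_image (fun j => p j - q j) s.toFinite ⟨i, hi⟩
  have hpos : 0 < p k - q k := (sub_pos.2 hlt).trans_le (hmax i hi)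
  have hle : p k ≤ q k + γ * (p k - q k) :=
    H _ hpos.le (fun j hj => sub_le_iff_le_add'.1 (hmax j hj)) k hk
  linarith [mul_lt_of_lt_one_left hpos hγ]

variable {X U A : Type*} {γ : ℝ} {T : ActionValue X U A → ActionValue X U A}

/-- Blackwell's conditions in one: `T` is monotone and discounts nonnegative constants by `γ`. -/
def IsDiscounting (γ : ℝ) (T : ActionValue X U A → ActionValue X U A) : Prop :=
  ∀ P Q c, 0 ≤ c → (∀ x u a, P x u a ≤ Q x u a + c) → ∀ x u a, T P x u a ≤ T Q x u a + γ * c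

namespace IsDiscounting

lemma lipschitzWith [Fintype X] [Fintype U] [Fintype A] (h0 : 0 ≤ γ) (hT : IsDiscounting γ T) :
    LipschitzWith ⟨γ, h0⟩ T := by
  have abs_sub_le : ∀ (P Q : ActionValue X U A) x u a, |P x u a - Q x u a| ≤ dist P Q :=
    fun P Q x u a => ((dist_le_pi_dist (P x u) (Q x u) a).trans
      (dist_le_pi_dist (P x) (Q x) u)).trans (dist_le_pi_dist P Q x)
  have sub_le : ∀ P Q x u a, T P x u a - T Q x u a ≤ γ * dist P Q := fun P Q x u a =>
    sub_le_iff_le_add'.2 <| hT P Q _ dist_nonneg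
      (fun x u a => sub_le_iff_le_add'.1 (le_of_abs_le (abs_sub_le P Q x u a))) x u a
  refine LipschitzWith.of_dist_le_mul fun P Q => ?_
  have hc : 0 ≤ γ * dist P Q := mul_nonneg h0 dist_nonneg
  refine (dist_pi_le_iff hc).2 fun x => (dist_pi_le_iff hc).2 fun u =>
    (dist_pi_le_iff hc).2 fun a => ?_
  rw [Real.dist_eq]
  exact abs_sub_le_iff.2 ⟨sub_le P Q x u a, dist_comm P Q ▸ sub_le Q P x u a⟩

variable [Finite X] [Finite U] [Finite A]

lemma exists_fixed (h0 : 0 ≤ γ) (h1 : γ < 1) (hT : IsDiscounting γ T) : ∃ Q, T Q = Q := by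
  cases nonempty_fintype X
  cases nonempty_fintype U
  cases nonempty_fintype A
  have hcontr : ContractingWith ⟨γ, h0⟩ T := ⟨h1, hT.lipschitzWith h0⟩
  exact ⟨_, hcontr.fixedPoint_isFixedPt⟩

lemma le_of_sub_super (h1 : γ < 1) (hT : IsDiscounting γ T) {P Q : ActionValue X U A}
    (hP : P ≤ T P) (hQ : T Q ≤ Q) : P ≤ Q := by
  intro x u a
  refine le_of_forall_le_add_mul h1 (s := Set.univ) (p := fun i : X × U × A => P i.1 i.2.1 i.2.2)
    (q := fun i => Q i.1 i.2.1 i.2.2) (fun c hc hPQ i _ => ?_) (x, u, a) trivial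
  calc P i.1 i.2.1 i.2.2 ≤ T P i.1 i.2.1 i.2.2 := hP _ _ _
    _ ≤ T Q i.1 i.2.1 i.2.2 + γ * c :=
      hT P Q c hc (fun x u a => hPQ (x, u, a) trivial) _ _ _
    _ ≤ Q i.1 i.2.1 i.2.2 + γ * c := add_le_add_left (hQ _ _ _) _

lemma fixed_unique (h1 : γ < 1) (hT : IsDiscounting γ T) {P Q : ActionValue X U A}
    (hP : T P = P) (hQ : T Q = Q) : P = Q :=
  le_antisymm (hT.le_of_sub_super h1 hP.ge hQ.le) (hT.le_of_sub_super h1 hQ.ge hP.le)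

end IsDiscounting

end Discounting

section Distributions

variable {ι : Type*} [Fintype ι] {ρ : stdSimplex ℝ ι} {p q : ι → ℝ} {c : ℝ}

lemma sum_le_sum_add (ρ : stdSimplex ℝ ι) (hpq : ∀ i, 0 < ρ i → p i ≤ q i + c) :
    ∑ i, ρ i * p i ≤ ∑ i, ρ i * q i + c := by
  have hc : ∑ i, ρ i * (q i + c) = ∑ i, ρ i * q i + c := by
    simp only [mul_add, Finset.sum_add_distrib, ← Finset.sum_mul, stdSimplex.sum_eq_one, one_mul]
  rw [← hc]
  refine Finset.sum_le_sum fun i _ => ?_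
  rcases (stdSimplex.zero_le ρ i).eq_or_lt with h0 | hpos
  · simp [← h0]
  · exact mul_le_mul_of_nonneg_left (hpq i hpos) hpos.le

lemma le_sum_of_forall_le (ρ : stdSimplex ℝ ι) (hq : ∀ i, c ≤ q i) : c ≤ ∑ i, ρ i * q i := by
  have := sum_le_sum_add (p := fun _ => c) (c := 0) ρ fun i _ => (hq i).trans (add_zero _).ge
  rwa [← Finset.sum_mul, stdSimplex.sum_eq_one, one_mul, add_zero] at this

lemma exists_pos (ρ : stdSimplex ℝ ι) : ∃ i, 0 < ρ i := by
  by_contra! hρ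
  have := stdSimplex.sum_eq_one ρ
  linarith [Finset.sum_nonpos fun i (_ : i ∈ Finset.univ) => hρ i]

lemma barycenter_pos [Nonempty ι] (i : ι) : 0 < (stdSimplex.barycenter : stdSimplex ℝ ι) i := by
  change 0 < (Fintype.card ι : ℝ)⁻¹
  positivity

lemma eq_of_apply_eq_one_of_pos {i j : ι} (hi : ρ i = 1) (hj : 0 < ρ j) : j = i := by
  classical
  by_contra hij
  have hle := Finset.sum_le_sum_of_subset_of_nonneg (f := fun i => ρ i)
    (Finset.subset_univ {j, i}) fun i _ _ => stdSimplex.zero_le ρ i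
  rw [Finset.sum_pair hij, stdSimplex.sum_eq_one] at hle
  linarith

lemma continuous_stdSimplex_apply (i : ι) : Continuous fun ρ : stdSimplex ℝ ι => ρ i :=
  (continuous_apply i).comp continuous_subtype_val

/-- The distributions that give no mass to the complement of `s`. -/
def carriedBy (s : Set ι) : Set (stdSimplex ℝ ι) := {ρ | ∀ i, i ∉ s → ρ i = 0}

lemma mem_carriedBy_iff {s : Set ι} : ρ ∈ carriedBy s ↔ ∀ i, 0 < ρ i → i ∈ s :=
  forall_congr' fun i => by rw [(stdSimplex.zero_le ρ i).lt_iff_ne', not_imp_comm]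

lemma carriedBy_nonempty {s : Set ι} (hs : s.Nonempty) : (carriedBy s).Nonempty := by
  classical
  obtain ⟨i, hi⟩ := hs
  refine ⟨stdSimplex.vertex i, mem_carriedBy_iff.2 fun j hj => ?_⟩
  rwa [eq_of_apply_eq_one_of_pos (ρ := stdSimplex.vertex i) (i := i) (by simp) hj]

lemma isClosed_carriedBy (s : Set ι) : IsClosed (carriedBy s) := by
  simp only [carriedBy, Set.ofPred_forall]
  exact isClosed_iInter fun i => isClosed_iInter fun _ =>
    isClosed_eq (continuous_stdSimplex_apply i) continuous_const

end Distributions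

section Performance

variable {X U A : Type*} [Fintype U]

/-- Worst-case expected value at `x` of the mixed action `ρ`, which the adversary does not
observe. -/
noncomputable def gameValue (Q : ActionValue X U A) (ρ : stdSimplex ℝ U) (x : X) : ℝ :=
  ⨅ a, ∑ u, ρ u * Q x u a

section GameValue

variable [Finite A] [Nonempty A] {P Q : ActionValue X U A} {ρ : stdSimplex ℝ U} {x : X} {c : ℝ}

lemma gameValue_le_add (hPQ : ∀ u, 0 < ρ u → ∀ a, P x u a ≤ Q x u a + c) :
    gameValue P ρ x ≤ gameValue Q ρ x + c :=
  iInf_le_iInf_add fun a => sum_le_sum_add ρ fun u hu => hPQ u hu a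

lemma gameValue_mono (hPQ : ∀ u, 0 < ρ u → ∀ a, P x u a ≤ Q x u a) :
    gameValue P ρ x ≤ gameValue Q ρ x := by
  simpa using gameValue_le_add (c := 0) fun u hu a => (hPQ u hu a).trans (add_zero _).ge

lemma continuous_gameValue (Q : ActionValue X U A) (x : X) :
    Continuous fun ρ : stdSimplex ℝ U => gameValue Q ρ x :=
  continuous_iInf_of_finite fun _ =>
    continuous_finsetSum _ fun u _ => (continuous_stdSimplex_apply u).mul continuous_const

end GameValue

variable {f : X → U → A → X} {r : ActionValue X U A} {γ : ℝ} {π : Policy X U}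

lemma performanceOp_apply (Q : ActionValue X U A) (x : X) (u : U) (a : A) :
    performanceOp f r γ π Q x u a = r x u a + γ * gameValue Q (π (f x u a)) (f x u a) := rfl

lemma isDiscounting_performanceOp [Finite A] [Nonempty A] (h0 : 0 ≤ γ) (π : Policy X U) :
    IsDiscounting γ (performanceOp f r γ π) := by
  intro P Q c _ hPQ x u a
  rw [performanceOp_apply, performanceOp_apply, add_assoc, ← mul_add]
  gcongr
  exact gameValue_le_add fun u' _ a' => hPQ _ u' a'

variable [Fintype A] {μ : Policy X A}

lemma stateValue_eq_gameValue (x : X) :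
    stateValue f r γ π x = gameValue (policyValue f r γ π) (π x) x := rfl

/-- Self-consistency operator of a pair of policies. -/
noncomputable def pairOp (f : X → U → A → X) (r : ActionValue X U A) (γ : ℝ)
    (π : Policy X U) (μ : Policy X A) (Q : ActionValue X U A) : ActionValue X U A :=
  fun x u a => r x u a + γ * stepExpectation f π μ Q x u a

lemma stepExpectation_le_add {P Q : ActionValue X U A} {c : ℝ}
    (hPQ : ∀ x u a, P x u a ≤ Q x u a + c) (x : X) (u : U) (a : A) :
    stepExpectation f π μ P x u a ≤ stepExpectation f π μ Q x u a + c :=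
  sum_le_sum_add _ fun _ _ => sum_le_sum_add _ fun _ _ => hPQ _ _ _

lemma stepExpectation_neg (Q : ActionValue X U A) :
    stepExpectation f π μ (-Q) = -stepExpectation f π μ Q := by
  ext x u a
  simp [stepExpectation]

lemma stepExpectation_zero : stepExpectation f π μ 0 = 0 := by
  ext x u a
  simp [stepExpectation]

lemma abs_stepExpectation_le {Q : ActionValue X U A} {B : ℝ} (hQ : ∀ x u a, |Q x u a| ≤ B)
    (x : X) (u : U) (a : A) : |stepExpectation f π μ Q x u a| ≤ B := by
  have le_bound : ∀ P : ActionValue X U A, (∀ x u a, P x u a ≤ B) →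
      stepExpectation f π μ P x u a ≤ B := fun P hP => by
    simpa [stepExpectation_zero] using stepExpectation_le_add (f := f) (π := π) (μ := μ)
      (P := P) (Q := 0) (c := B) (fun x u a => by simpa using hP x u a) x u a
  refine abs_le'.2 ⟨le_bound Q fun x u a => le_of_abs_le (hQ x u a), ?_⟩
  have := le_bound (-Q) fun x u a => (neg_le_abs _).trans (hQ x u a)
  rwa [stepExpectation_neg] at this

lemma isDiscounting_pairOp (h0 : 0 ≤ γ) (π : Policy X U) (μ : Policy X A) :
    IsDiscounting γ (pairOp f r γ π μ) := by
  intro P Q c _ hPQ x u a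
  rw [pairOp, pairOp, add_assoc, ← mul_add]
  gcongr
  exact stepExpectation_le_add hPQ x u a

lemma hasSum_stepExpectation {ι : Type*} {g : ι → ActionValue X U A} {S : ActionValue X U A}
    (hg : ∀ x u a, HasSum (fun i => g i x u a) (S x u a)) (x : X) (u : U) (a : A) :
    HasSum (fun i => stepExpectation f π μ (g i) x u a) (stepExpectation f π μ S x u a) :=
  hasSum_sum fun _ _ => (hasSum_sum fun _ _ => (hg _ _ _).mul_left _).mul_left _

lemma stepExpectation_const_mul (c : ℝ) (Q : ActionValue X U A) (x : X) (u : U) (a : A) :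
    stepExpectation f π μ (fun x u a => c * Q x u a) x u a = c * stepExpectation f π μ Q x u a := by
  simp only [stepExpectation, Finset.mul_sum, mul_left_comm c]

lemma performanceOp_le_pairOp (h0 : 0 ≤ γ) (π : Policy X U) (μ : Policy X A)
    (Q : ActionValue X U A) : performanceOp f r γ π Q ≤ pairOp f r γ π μ Q := by
  intro x u a
  have hswap : stepExpectation f π μ Q x u a =
      ∑ a', μ (f x u a) a' * ∑ u', π (f x u a) u' * Q (f x u a) u' a' := by
    simp only [stepExpectation, Finset.mul_sum]
    rw [Finset.sum_comm]
    simp only [mul_left_comm]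
  rw [performanceOp_apply, pairOp, hswap]
  gcongr
  exact le_sum_of_forall_le _ fun a' =>
    Finite.ciInf_le (fun a' => ∑ u', π (f x u a) u' * Q (f x u a) u' a') a'

lemma exists_pairOp_eq_performanceOp [Nonempty A] (f : X → U → A → X) (r : ActionValue X U A)
    (γ : ℝ) (π : Policy X U) (Q : ActionValue X U A) :
    ∃ μ : Policy X A, pairOp f r γ π μ Q = performanceOp f r γ π Q := by
  classical
  choose k hk using fun x => exists_eq_ciInf_of_finite (f := fun a => ∑ u, π x u * Q x u a)
  refine ⟨fun x => stdSimplex.vertex (k x), ?_⟩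
  ext x u a
  simp [pairOp, performanceOp, stepExpectation, ← hk, Pi.single_apply]

variable [Finite X]

lemma summable_pairValue (h0 : 0 ≤ γ) (h1 : γ < 1) (π : Policy X U) (μ : Policy X A)
    (x : X) (u : U) (a : A) :
    Summable fun t : ℕ => γ ^ t * (stepExpectation f π μ)^[t] r x u a := by
  obtain ⟨B, hB⟩ := Finite.bddAbove_range (fun i : X × U × A => |r i.1 i.2.1 i.2.2|)
  have iterate_le : ∀ t x u a, |(stepExpectation f π μ)^[t] r x u a| ≤ B := by
    intro t
    induction t with
    | zero => exact fun x u a => hB ⟨(x, u, a), rfl⟩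
    | succ t ih =>
      rw [Function.iterate_succ_apply']
      exact abs_stepExpectation_le ih
  refine Summable.of_norm_bounded ((summable_geometric_of_lt_one h0 h1).mul_right B) fun t => ?_
  rw [Real.norm_eq_abs, abs_mul, abs_of_nonneg (pow_nonneg h0 t)]
  exact mul_le_mul_of_nonneg_left (iterate_le t x u a) (pow_nonneg h0 t)

lemma pairOp_pairValue (h0 : 0 ≤ γ) (h1 : γ < 1) (π : Policy X U) (μ : Policy X A) :
    pairOp f r γ π μ (pairValue f r γ π μ) = pairValue f r γ π μ := by
  have hsum := summable_pairValue (f := f) (r := r) h0 h1 π μ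
  ext x u a
  have htail : HasSum (fun t => γ ^ (t + 1) * (stepExpectation f π μ)^[t + 1] r x u a)
      (γ * stepExpectation f π μ (pairValue f r γ π μ) x u a) := by
    have hstep := (hasSum_stepExpectation (f := f) (π := π) (μ := μ)
      (S := pairValue f r γ π μ) (fun x u a => (hsum x u a).hasSum) x u a).mul_left γ
    simpa only [stepExpectation_const_mul, ← mul_assoc, ← pow_succ',
      ← Function.iterate_succ_apply' (stepExpectation f π μ)] using hstep
  rw [pairOp, pairValue, (hsum x u a).tsum_eq_zero_add, htail.tsum_eq]
  simp

variable [Nonempty A]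

lemma policyValue_eq_of_fixed (h0 : 0 ≤ γ) (h1 : γ < 1) {Q : ActionValue X U A}
    (hQ : performanceOp f r γ π Q = Q) : policyValue f r γ π = Q := by
  have le_pairValue : ∀ μ, Q ≤ pairValue f r γ π μ := fun μ =>
    (isDiscounting_pairOp h0 π μ).le_of_sub_super h1
      (hQ.ge.trans (performanceOp_le_pairOp h0 π μ Q)) (pairOp_pairValue h0 h1 π μ).le
  obtain ⟨μ, hμ⟩ := exists_pairOp_eq_performanceOp f r γ π Q
  have pairValue_eq : pairValue f r γ π μ = Q :=
    (isDiscounting_pairOp h0 π μ).fixed_unique h1 (pairOp_pairValue h0 h1 π μ) (hμ.trans hQ)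
  ext x u a
  refine IsLeast.csInf_eq ⟨⟨μ, by simp only [pairValue_eq]⟩, ?_⟩
  rintro _ ⟨ν, rfl⟩
  exact le_pairValue ν x u a

lemma performanceOp_policyValue (h0 : 0 ≤ γ) (h1 : γ < 1) (π : Policy X U) :
    performanceOp f r γ π (policyValue f r γ π) = policyValue f r γ π := by
  obtain ⟨Q, hQ⟩ := (isDiscounting_performanceOp (f := f) (r := r) h0 π).exists_fixed h0 h1
  rwa [policyValue_eq_of_fixed h0 h1 hQ]

end Performance

section ActionConstraint

variable {X U A : Type*} [Fintype U] {C : X → Set U} {P Q : ActionValue X U A}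

/-- Optimal worst-case one-shot value at `x` over the mixed actions carried by `C x`; it takes the
junk value `0` where `C x` is empty. -/
noncomputable def constrainedValue (C : X → Set U) (Q : ActionValue X U A) (x : X) : ℝ :=
  ⨆ ρ : carriedBy (C x), gameValue Q ρ x

/-- The policies that obey the action constraint `C` wherever it can be obeyed. -/
def respecting (C : X → Set U) : Set (Policy X U) :=
  {π | ∀ x, (C x).Nonempty → π x ∈ carriedBy (C x)}

/-- Policies that solve the one-shot game with value `Q` and action constraint `C` at every state
where `C` can be obeyed. -/
def IsGreedy (C : X → Set U) (Q : ActionValue X U A) (π : Policy X U) : Prop :=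
  ∀ x, (C x).Nonempty →
    π x ∈ carriedBy (C x) ∧ gameValue Q (π x) x = constrainedValue C Q x

/-- An action constraint that can be obeyed forever. -/
def IsInvariantConstraint (f : X → U → A → X) (C : X → Set U) : Prop :=
  ∀ x, ∀ u ∈ C x, ∀ a, (C (f x u a)).Nonempty

/-- Sets of state-action pairs that are never left when the protagonist follows `π`, whatever the
adversary does. -/
def IsPlayClosed (f : X → U → A → X) (π : Policy X U) (D : Set (X × U)) : Prop :=
  ∀ x u, (x, u) ∈ D → ∀ a u', 0 < π (f x u a) u' → (f x u a, u') ∈ D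

/-- The pairs `(x, u)` with `u ∈ C x`. -/
def constraintGraph (C : X → Set U) : Set (X × U) := {i | i.2 ∈ C i.1}

lemma IsGreedy.mem_respecting {π : Policy X U} (hπ : IsGreedy C Q π) : π ∈ respecting C :=
  fun x hx => (hπ x hx).1

lemma isClosed_respecting (C : X → Set U) : IsClosed (respecting C) := by
  simp only [respecting, Set.ofPred_forall]
  exact isClosed_iInter fun x => isClosed_iInter fun _ =>
    (isClosed_carriedBy (C x)).preimage (continuous_apply x)

lemma IsInvariantConstraint.isPlayClosed {f : X → U → A → X} (hC : IsInvariantConstraint f C)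
    {π : Policy X U} (hπ : π ∈ respecting C) : IsPlayClosed f π (constraintGraph C) :=
  fun x u hu a => mem_carriedBy_iff.1 (hπ _ (hC x u hu a))

section ConstrainedValue

variable [Finite A] [Nonempty A] {x : X}

lemma gameValue_le_constrainedValue (Q : ActionValue X U A) {ρ : stdSimplex ℝ U}
    (hρ : ρ ∈ carriedBy (C x)) : gameValue Q ρ x ≤ constrainedValue C Q x := by
  have : CompactSpace (carriedBy (C x)) :=
    isCompact_iff_compactSpace.1 (isClosed_carriedBy _).isCompact
  exact le_ciSup (isCompact_range ((continuous_gameValue Q x).comp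
    continuous_subtype_val)).bddAbove (⟨ρ, hρ⟩ : carriedBy (C x))

lemma exists_gameValue_eq_constrainedValue (Q : ActionValue X U A) (hx : (C x).Nonempty) :
    ∃ ρ ∈ carriedBy (C x), gameValue Q ρ x = constrainedValue C Q x := by
  have : CompactSpace (carriedBy (C x)) :=
    isCompact_iff_compactSpace.1 (isClosed_carriedBy _).isCompact
  have : Nonempty (carriedBy (C x)) := (carriedBy_nonempty hx).to_subtype
  obtain ⟨ρ, hρ⟩ := (isCompact_range ((continuous_gameValue Q x).comp
    (continuous_subtype_val (p := (· ∈ carriedBy (C x)))))).sSup_mem (Set.range_nonempty _)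
  exact ⟨ρ, ρ.2, hρ⟩

lemma exists_isGreedy [Nonempty U] (C : X → Set U) (Q : ActionValue X U A) :
    ∃ π, IsGreedy C Q π := by
  choose! π hπ using fun x (hx : (C x).Nonempty) => exists_gameValue_eq_constrainedValue Q hx
  exact ⟨π, hπ⟩

lemma constrainedValue_le_add {c : ℝ} (hc : 0 ≤ c)
    (hPQ : ∀ u ∈ C x, ∀ a, P x u a ≤ Q x u a + c) :
    constrainedValue C P x ≤ constrainedValue C Q x + c := by
  rcases isEmpty_or_nonempty (carriedBy (C x)) with hempty | hne
  · simpa [constrainedValue] using hc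
  refine ciSup_le fun ρ => (gameValue_le_add fun u hu => ?_).trans
    (add_le_add_left (gameValue_le_constrainedValue Q ρ.2) c)
  exact hPQ u (mem_carriedBy_iff.1 ρ.2 u hu)

end ConstrainedValue

variable {f : X → U → A → X} {r : ActionValue X U A} {γ : ℝ}

/-- Bellman operator of the Markov game with action constraint `C`. -/
noncomputable def constrainedOp (f : X → U → A → X) (r : ActionValue X U A) (γ : ℝ)
    (C : X → Set U) (Q : ActionValue X U A) : ActionValue X U A :=
  fun x u a => r x u a + γ * constrainedValue C Q (f x u a)

lemma isDiscounting_constrainedOp [Finite A] [Nonempty A] (h0 : 0 ≤ γ) (C : X → Set U) :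
    IsDiscounting γ (constrainedOp f r γ C) := by
  intro P Q c hc hPQ x u a
  rw [constrainedOp, constrainedOp, add_assoc, ← mul_add]
  gcongr
  exact constrainedValue_le_add hc fun u' _ a' => hPQ _ u' a'

lemma performanceOp_le_constrainedOp [Finite A] [Nonempty A] (h0 : 0 ≤ γ) {π : Policy X U} {x : X}
    {u : U} {a : A} (hπ : π (f x u a) ∈ carriedBy (C (f x u a))) :
    performanceOp f r γ π Q x u a ≤ constrainedOp f r γ C Q x u a := by
  rw [performanceOp_apply, constrainedOp]
  gcongr
  exact gameValue_le_constrainedValue Q hπ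

lemma IsGreedy.performanceOp_eq {π : Policy X U} (hπ : IsGreedy C Q π)
    (hC : IsInvariantConstraint f C) {x : X} {u : U} (hu : u ∈ C x) (a : A) :
    performanceOp f r γ π Q x u a = constrainedOp f r γ C Q x u a := by
  rw [performanceOp_apply, constrainedOp, (hπ _ (hC x u hu a)).2]

variable [Finite X] [Finite A] [Nonempty A] {π π' : Policy X U} {D : Set (X × U)}

lemma le_of_sub_super_of_isPlayClosed (h0 : 0 ≤ γ) (h1 : γ < 1) (hD : IsPlayClosed f π D)
    (hP : ∀ x u, (x, u) ∈ D → ∀ a, P x u a ≤ performanceOp f r γ π P x u a)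
    (hQ : ∀ x u, (x, u) ∈ D → ∀ a, performanceOp f r γ π Q x u a ≤ Q x u a)
    {x : X} {u : U} (hxu : (x, u) ∈ D) (a : A) : P x u a ≤ Q x u a := by
  refine le_of_forall_le_add_mul h1 (s := {i : X × U × A | (i.1, i.2.1) ∈ D})
    (p := fun i => P i.1 i.2.1 i.2.2) (q := fun i => Q i.1 i.2.1 i.2.2) ?_ (x, u, a) hxu
  rintro c - hPQ ⟨x, u, a⟩ hxu
  have hgame : gameValue P (π (f x u a)) (f x u a) ≤ gameValue Q (π (f x u a)) (f x u a) + c :=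
    gameValue_le_add fun u' hu' a' => hPQ (f x u a, u', a') (hD x u hxu a u' hu')
  calc P x u a ≤ r x u a + γ * gameValue P (π (f x u a)) (f x u a) := hP x u hxu a
    _ ≤ r x u a + γ * (gameValue Q (π (f x u a)) (f x u a) + c) := by gcongr
    _ = performanceOp f r γ π Q x u a + γ * c := by rw [performanceOp_apply]; ring
    _ ≤ Q x u a + γ * c := add_le_add_left (hQ x u hxu a) _

lemma le_of_isGreedy (h0 : 0 ≤ γ) (h1 : γ < 1) (hC : IsInvariantConstraint f C)
    (hπ : π ∈ respecting C) (hP : performanceOp f r γ π P = P) (hπ' : IsGreedy C P π')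
    (hQ : performanceOp f r γ π' Q = Q) {x : X} {u : U} (hu : u ∈ C x) (a : A) :
    P x u a ≤ Q x u a := by
  refine le_of_sub_super_of_isPlayClosed h0 h1 (hC.isPlayClosed hπ'.mem_respecting)
    (fun x u hu a => ?_) (fun x u _ a => (congrFun₃ hQ x u a).le) hu a
  rw [hπ'.performanceOp_eq hC hu]
  exact (congrFun₃ hP x u a).ge.trans (performanceOp_le_constrainedOp h0 (hπ _ (hC x u hu a)))

end ActionConstraint

section ConstrainedOptimality

variable {X U A : Type*} [Finite X] [Fintype U] [Fintype A] [Nonempty A] {f : X → U → A → X}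
  {r : ActionValue X U A} {γ : ℝ} {C : X → Set U} {Qo : ActionValue X U A} {π : Policy X U}

lemma policyValue_le_of_isPlayClosed (h0 : 0 ≤ γ) (h1 : γ < 1)
    (hQo : constrainedOp f r γ C Qo = Qo) {D : Set (X × U)} (hD : IsPlayClosed f π D)
    (hDC : D ⊆ constraintGraph C) {x : X} {u : U} (hxu : (x, u) ∈ D) (a : A) :
    policyValue f r γ π x u a ≤ Qo x u a := by
  refine le_of_sub_super_of_isPlayClosed h0 h1 hD
    (fun x u _ a => (congrFun₃ (performanceOp_policyValue h0 h1 π) x u a).ge)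
    (fun x u hxu a => ?_) hxu a
  exact (performanceOp_le_constrainedOp h0 (mem_carriedBy_iff.2 fun u' hu' =>
    hDC (hD x u hxu a u' hu'))).trans (congrFun₃ hQo x u a).le

lemma stateValue_le_gameValue_of_isPlayClosed (h0 : 0 ≤ γ) (h1 : γ < 1)
    (hQo : constrainedOp f r γ C Qo = Qo) {D : Set (X × U)} (hD : IsPlayClosed f π D)
    (hDC : D ⊆ constraintGraph C) {x : X} (hx : ∀ u, 0 < π x u → (x, u) ∈ D) :
    stateValue f r γ π x ≤ gameValue Qo (π x) x :=
  gameValue_mono fun u hu => policyValue_le_of_isPlayClosed h0 h1 hQo hD hDC (hx u hu)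

variable (hC : IsInvariantConstraint f C)
include hC

lemma stateValue_le_gameValue (h0 : 0 ≤ γ) (h1 : γ < 1) (hQo : constrainedOp f r γ C Qo = Qo)
    (hπ : π ∈ respecting C) {x : X} (hx : (C x).Nonempty) :
    stateValue f r γ π x ≤ gameValue Qo (π x) x :=
  stateValue_le_gameValue_of_isPlayClosed h0 h1 hQo (hC.isPlayClosed hπ) subset_rfl
    (mem_carriedBy_iff.1 (hπ x hx))

lemma stateValue_le_constrainedValue (h0 : 0 ≤ γ) (h1 : γ < 1)
    (hQo : constrainedOp f r γ C Qo = Qo) (hπ : π ∈ respecting C) {x : X} (hx : (C x).Nonempty) :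
    stateValue f r γ π x ≤ constrainedValue C Qo x :=
  (stateValue_le_gameValue hC h0 h1 hQo hπ hx).trans (gameValue_le_constrainedValue Qo (hπ x hx))

lemma IsGreedy.stateValue_eq (h0 : 0 ≤ γ) (h1 : γ < 1) (hQo : constrainedOp f r γ C Qo = Qo)
    (hπ : IsGreedy C Qo π) {x : X} (hx : (C x).Nonempty) :
    stateValue f r γ π x = constrainedValue C Qo x := by
  refine (stateValue_le_constrainedValue hC h0 h1 hQo hπ.mem_respecting hx).antisymm ?_
  have le_policyValue : ∀ x u, u ∈ C x → ∀ a, Qo x u a ≤ policyValue f r γ π x u a := by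
    intro x u hu
    refine le_of_sub_super_of_isPlayClosed h0 h1 (hC.isPlayClosed hπ.mem_respecting)
      (fun x u hu a => ?_)
      (fun x u _ a => (congrFun₃ (performanceOp_policyValue h0 h1 π) x u a).le) hu
    rw [hπ.performanceOp_eq hC hu, hQo]
  rw [← (hπ x hx).2]
  exact gameValue_mono fun u hu => le_policyValue x u (mem_carriedBy_iff.1 (hπ x hx).1 u hu)

lemma isGreatest_stateValue [Nonempty U] (h0 : 0 ≤ γ) (h1 : γ < 1)
    (hQo : constrainedOp f r γ C Qo = Qo) {x : X} (hx : (C x).Nonempty) :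
    IsGreatest ((fun π => stateValue f r γ π x) '' respecting C) (constrainedValue C Qo x) := by
  obtain ⟨π, hπ⟩ := exists_isGreedy C Qo
  exact ⟨⟨π, hπ.mem_respecting, hπ.stateValue_eq hC h0 h1 hQo hx⟩,
    Set.forall_mem_image.2 fun π' hπ' => stateValue_le_constrainedValue hC h0 h1 hQo hπ' hx⟩

end ConstrainedOptimality

section ConstrainedPolicyIteration

variable {X U A : Type*} [Fintype U] {f : X → U → A → X} {r : ActionValue X U A} {γ : ℝ}
  {C : X → Set U} {π : ℕ → Policy X U} {Q : ℕ → ActionValue X U A} {Qo : ActionValue X U A}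

/-- Policy iteration for the Markov game with action constraint `C`: `Q j` is the value of `π j`,
and `π (j + 1)` is greedy for `Q j`. -/
structure IsConstrainedPolicyIteration (f : X → U → A → X) (r : ActionValue X U A) (γ : ℝ)
    (C : X → Set U) (π : ℕ → Policy X U) (Q : ℕ → ActionValue X U A) : Prop where
  start : π 0 ∈ respecting C
  evaluation : ∀ j, performanceOp f r γ (π j) (Q j) = Q j
  improvement : ∀ j, IsGreedy C (Q j) (π (j + 1))

namespace IsConstrainedPolicyIteration

lemma mem_respecting (hrun : IsConstrainedPolicyIteration f r γ C π Q) :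
    ∀ j, π j ∈ respecting C
  | 0 => hrun.start
  | j + 1 => (hrun.improvement j).mem_respecting

variable [Finite X] (hrun : IsConstrainedPolicyIteration f r γ C π Q) (h0 : 0 ≤ γ) (h1 : γ < 1)
  (hC : IsInvariantConstraint f C)
include hrun h0 h1 hC

section Gap

variable [Finite A] [Nonempty A] {x : X} {u : U}

lemma le_succ (j : ℕ) (hu : u ∈ C x) (a : A) : Q j x u a ≤ Q (j + 1) x u a :=
  le_of_isGreedy h0 h1 hC (hrun.mem_respecting j) (hrun.evaluation j) (hrun.improvement j)
    (hrun.evaluation (j + 1)) hu a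

variable (hQo : constrainedOp f r γ C Qo = Qo)
include hQo

lemma gap_succ {j : ℕ} {c : ℝ} (hc : 0 ≤ c)
    (hj : ∀ x, ∀ u ∈ C x, ∀ a, Qo x u a ≤ Q j x u a + c) (hu : u ∈ C x) (a : A) :
    Qo x u a ≤ Q (j + 1) x u a + γ * c := by
  have hx' : (C (f x u a)).Nonempty := hC x u hu a
  have hcarried := mem_carriedBy_iff.1 (hrun.mem_respecting (j + 1) _ hx')
  calc Qo x u a = r x u a + γ * constrainedValue C Qo (f x u a) := (congrFun₃ hQo x u a).symm
    _ ≤ r x u a + γ * (constrainedValue C (Q j) (f x u a) + c) := by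
      gcongr
      exact constrainedValue_le_add hc (hj (f x u a))
    _ = r x u a + γ * gameValue (Q j) (π (j + 1) (f x u a)) (f x u a) + γ * c := by
      rw [(hrun.improvement j _ hx').2]
      ring
    _ ≤ r x u a + γ * gameValue (Q (j + 1)) (π (j + 1) (f x u a)) (f x u a) + γ * c := by
      gcongr
      exact gameValue_mono fun u' hu' a' => hrun.le_succ h0 h1 hC j (hcarried u' hu') a'
    _ = Q (j + 1) x u a + γ * c := by rw [← performanceOp_apply, hrun.evaluation]

lemma exists_gap_le : ∃ B, 0 ≤ B ∧ ∀ j x, ∀ u ∈ C x, ∀ a, Qo x u a ≤ Q j x u a + γ ^ j * B := by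
  obtain ⟨B, hB⟩ := Finite.bddAbove_range
    (fun i : X × U × A => |Qo i.1 i.2.1 i.2.2 - Q 0 i.1 i.2.1 i.2.2|)
  have abs_le : ∀ x u a, |Qo x u a - Q 0 x u a| ≤ B := fun x u a => hB ⟨(x, u, a), rfl⟩
  refine ⟨max B 0, le_max_right B 0, fun j => ?_⟩
  induction j with
  | zero =>
    intro x u _ a
    have := (le_abs_self _).trans ((abs_le x u a).trans (le_max_left B 0))
    linarith
  | succ j ih =>
    intro x u hu a
    rw [pow_succ', mul_assoc]
    exact hrun.gap_succ h0 h1 hC hQo (mul_nonneg (pow_nonneg h0 j) (le_max_right B 0)) ih hu a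

end Gap

variable [Nonempty A] (hQo : constrainedOp f r γ C Qo = Qo) {x : X} (hx : (C x).Nonempty)
include hQo hx

lemma tendsto_stateValue [Fintype A] :
    Tendsto (fun j => stateValue f r γ (π j) x) atTop (𝓝 (constrainedValue C Qo x)) := by
  obtain ⟨B, hB0, hB⟩ := hrun.exists_gap_le h0 h1 hC hQo
  rw [← tendsto_add_atTop_iff_nat 1]
  have hlower : Tendsto (fun j : ℕ => constrainedValue C Qo x - γ ^ j * B) atTop
      (𝓝 (constrainedValue C Qo x)) := by
    simpa using ((tendsto_pow_atTop_nhds_zero_of_lt_one h0 h1).mul_const B).const_sub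
      (constrainedValue C Qo x)
  refine tendsto_of_tendsto_of_tendsto_of_le_of_le hlower tendsto_const_nhds (fun j => ?_)
    fun j => stateValue_le_constrainedValue hC h0 h1 hQo (hrun.mem_respecting _) hx
  rw [sub_le_iff_le_add]
  calc constrainedValue C Qo x ≤ constrainedValue C (Q j) x + γ ^ j * B :=
        constrainedValue_le_add (by positivity) (hB j x)
    _ = gameValue (Q j) (π (j + 1) x) x + γ ^ j * B := by rw [(hrun.improvement j x hx).2]
    _ ≤ stateValue f r γ (π (j + 1)) x + γ ^ j * B := by
      rw [stateValue_eq_gameValue, policyValue_eq_of_fixed h0 h1 (hrun.evaluation (j + 1))]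
      gcongr
      exact gameValue_mono fun u hu a => hrun.le_succ h0 h1 hC j
        (mem_carriedBy_iff.1 (hrun.mem_respecting (j + 1) x hx) u hu) a

lemma tendsto_gameValue [Finite A] :
    Tendsto (fun j => gameValue Qo (π j x) x) atTop (𝓝 (constrainedValue C Qo x)) := by
  cases nonempty_fintype A
  exact tendsto_of_tendsto_of_tendsto_of_le_of_le (hrun.tendsto_stateValue h0 h1 hC hQo hx)
    tendsto_const_nhds
    (fun j => stateValue_le_gameValue hC h0 h1 hQo (hrun.mem_respecting j) hx)
    fun j => gameValue_le_constrainedValue Qo (hrun.mem_respecting j x hx)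

end IsConstrainedPolicyIteration

end ConstrainedPolicyIteration

section Maximin

variable {X U A : Type*} {P Q : ActionValue X U A} {x : X} {u : U} {c : ℝ} {σ : X → U}

/-- Maximin value at `x` of the one-shot game with payoff `Q`, over deterministic actions that the
adversary observes. -/
noncomputable def maximin (Q : ActionValue X U A) (x : X) : ℝ := ⨆ u, ⨅ a, Q x u a

lemma mem_admissible_iff [Finite A] [Nonempty A] : u ∈ admissible Q x ↔ ∀ a, 0 ≤ Q x u a :=
  le_iInf_iff_of_finite

lemma iInf_le_maximin [Finite U] (Q : ActionValue X U A) (x : X) (u : U) :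
    ⨅ a, Q x u a ≤ maximin Q x :=
  Finite.le_ciSup (fun u => ⨅ a, Q x u a) u

variable [Finite U] [Nonempty U]

lemma mem_robustSet_iff_admissible_nonempty : x ∈ robustSet Q ↔ (admissible Q x).Nonempty :=
  le_iSup_iff_of_finite

lemma exists_isSafetyImprovement (Q : ActionValue X U A) : ∃ σ, IsSafetyImprovement Q σ := by
  choose σ hσ using fun x => Finite.exists_max fun u => ⨅ a, Q x u a
  exact ⟨σ, hσ⟩

lemma IsSafetyImprovement.iInf_eq (hσ : IsSafetyImprovement Q σ) (x : X) :
    ⨅ a, Q x (σ x) a = maximin Q x :=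
  (iInf_le_maximin Q x (σ x)).antisymm (ciSup_le (hσ x))

variable [Finite A] [Nonempty A]

lemma le_maximin_iff : c ≤ maximin Q x ↔ ∃ u, ∀ a, c ≤ Q x u a :=
  le_iSup_iff_of_finite.trans (exists_congr fun _ => le_iInf_iff_of_finite)

lemma maximin_le_add (hPQ : ∀ u a, P x u a ≤ Q x u a + c) : maximin P x ≤ maximin Q x + c :=
  iSup_le_iSup_add fun u => iInf_le_iInf_add (hPQ u)

lemma mem_robustSet_iff : x ∈ robustSet Q ↔ ∃ u, ∀ a, 0 ≤ Q x u a := le_maximin_iff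

lemma robustSet_mono (hPQ : P ≤ Q) : robustSet P ⊆ robustSet Q := fun _ hx =>
  have ⟨u, hu⟩ := mem_robustSet_iff.1 hx
  mem_robustSet_iff.2 ⟨u, fun a => (hu a).trans (hPQ _ u a)⟩

end Maximin

section SafetyBackup

variable {γh y p q c : ℝ}

/-- Discounted one-step safety value of a state with constraint value `y` and continuation
value `p`. -/
noncomputable def safetyBackup (γh y p : ℝ) : ℝ := (1 - γh) * y + γh * min y p

lemma safetyBackup_le_add (h0 : 0 ≤ γh) (hc : 0 ≤ c) (hpq : p ≤ q + c) :
    safetyBackup γh y p ≤ safetyBackup γh y q + γh * c := by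
  have hmin : min y p ≤ min y q + c := by
    rw [← min_add_add_right]
    exact min_le_min (le_add_of_nonneg_right hc) hpq
  rw [safetyBackup, safetyBackup, add_assoc, ← mul_add]
  gcongr

lemma safetyBackup_mono (h0 : 0 ≤ γh) (hpq : p ≤ q) :
    safetyBackup γh y p ≤ safetyBackup γh y q := by
  unfold safetyBackup
  gcongr

lemma safetyBackup_le (h0 : 0 ≤ γh) : safetyBackup γh y p ≤ y := by
  rw [safetyBackup]
  linarith [mul_le_mul_of_nonneg_left (min_le_left y p) h0]

lemma le_safetyBackup (h0 : 0 ≤ γh) (h1 : γh ≤ 1) (hy : c ≤ y) (hp : c ≤ p) :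
    c ≤ safetyBackup γh y p := by
  rw [safetyBackup]
  linarith [mul_le_mul_of_nonneg_left (le_min hy hp) h0,
    mul_le_mul_of_nonneg_left hy (sub_nonneg.2 h1)]

end SafetyBackup

section SafetyOperators

variable {X U A : Type*} {f : X → U → A → X} {h : X → ℝ} {γh : ℝ} {Q : ActionValue X U A}

lemma safetyBellmanOp_apply (Q : ActionValue X U A) (x : X) (u : U) (a : A) :
    safetyBellmanOp f h γh Q x u a = safetyBackup γh (h x) (maximin Q (f x u a)) := rfl

lemma le_constraint_of_fixed (h0 : 0 ≤ γh) (hQ : safetyBellmanOp f h γh Q = Q)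
    (x : X) (u : U) (a : A) : Q x u a ≤ h x :=
  (congrFun₃ hQ x u a).ge.trans (safetyBackup_le h0)

lemma isDiscounting_safetyPolicyOp [Finite A] [Nonempty A] (h0 : 0 ≤ γh) (σ : X → U) :
    IsDiscounting γh (safetyPolicyOp (A := A) f h γh σ) := fun _ _ _ hc hPQ _ _ _ =>
  safetyBackup_le_add h0 hc (iInf_le_iInf_add fun a => hPQ _ _ a)

variable [Finite U]

lemma safetyPolicyOp_le_safetyBellmanOp (h0 : 0 ≤ γh) (σ : X → U) (Q : ActionValue X U A) :
    safetyPolicyOp f h γh σ Q ≤ safetyBellmanOp f h γh Q := fun x u a =>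
  safetyBackup_mono h0 (iInf_le_maximin Q (f x u a) (σ (f x u a)))

variable [Nonempty U]

lemma IsSafetyImprovement.safetyPolicyOp_eq {σ : X → U} (hσ : IsSafetyImprovement Q σ) :
    safetyPolicyOp f h γh σ Q = safetyBellmanOp f h γh Q := by
  ext x u a
  rw [safetyPolicyOp, hσ.iInf_eq, safetyBellmanOp_apply, safetyBackup]

lemma isDiscounting_safetyBellmanOp [Finite A] [Nonempty A] (h0 : 0 ≤ γh) :
    IsDiscounting γh (safetyBellmanOp (U := U) (A := A) f h γh) := fun _ _ _ hc hPQ _ _ _ =>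
  safetyBackup_le_add h0 hc (maximin_le_add (hPQ _))

end SafetyOperators

section SafetyIteration

variable {X U A : Type*} {f : X → U → A → X} {h : X → ℝ} {γh : ℝ} {σ : ℕ → X → U}
  {Qh : ℕ → ActionValue X U A} {Qs : ActionValue X U A}

/-- Policy iteration for the discounted safety value: `Qh k` is the value of the deterministic
policy `σ k`, and `σ (k + 1)` is greedy for `Qh k`. -/
structure IsSafetyIteration (f : X → U → A → X) (h : X → ℝ) (γh : ℝ) (σ : ℕ → X → U)
    (Qh : ℕ → ActionValue X U A) : Prop where
  evaluation : ∀ k, safetyPolicyOp f h γh (σ k) (Qh k) = Qh k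
  improvement : ∀ k, IsSafetyImprovement (Qh k) (σ (k + 1))

variable [Finite X] [Finite U] [Nonempty U] [Finite A] [Nonempty A]

lemma exists_isSafetyIteration (h0 : 0 ≤ γh) (h1 : γh < 1) (σ₀ : X → U) :
    ∃ σ, ∃ Qh : ℕ → ActionValue X U A, σ 0 = σ₀ ∧ IsSafetyIteration f h γh σ Qh := by
  choose eval heval using fun σ : X → U =>
    (isDiscounting_safetyPolicyOp (A := A) (f := f) (h := h) h0 σ).exists_fixed h0 h1
  choose improve himprove using exists_isSafetyImprovement (X := X) (U := U) (A := A)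
  refine ⟨fun k => (improve ∘ eval)^[k] σ₀, fun k => eval ((improve ∘ eval)^[k] σ₀), rfl,
    fun k => heval _, fun k => ?_⟩
  rw [Function.iterate_succ_apply']
  exact himprove _

namespace IsSafetyIteration

variable (hrun : IsSafetyIteration f h γh σ Qh) (h0 : 0 ≤ γh) (h1 : γh < 1)
include hrun h0 h1

lemma le_succ (k : ℕ) : Qh k ≤ Qh (k + 1) := by
  refine (isDiscounting_safetyPolicyOp h0 (σ (k + 1))).le_of_sub_super h1 ?_
    (hrun.evaluation (k + 1)).le
  rw [(hrun.improvement k).safetyPolicyOp_eq]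
  exact (hrun.evaluation k).ge.trans (safetyPolicyOp_le_safetyBellmanOp h0 _ _)

variable (hQs : safetyBellmanOp f h γh Qs = Qs)
include hQs

lemma le_fixed (k : ℕ) : Qh k ≤ Qs :=
  (isDiscounting_safetyBellmanOp h0).le_of_sub_super h1
    ((hrun.evaluation k).ge.trans (safetyPolicyOp_le_safetyBellmanOp h0 _ _)) hQs.le

lemma eventually_eq : ∀ᶠ k in atTop, Qh k = Qs := by
  have hmono : Monotone Qh := monotone_nat_of_le_succ (hrun.le_succ h0 h1)
  obtain ⟨i, hi⟩ : ∃ i, Qh i = Qh (i + 1) := by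
    obtain ⟨i, j, hij, hσ⟩ := Finite.exists_ne_map_eq_of_infinite σ
    have heq : Qh i = Qh j := (isDiscounting_safetyPolicyOp h0 (σ i)).fixed_unique h1
      (hrun.evaluation i) (hσ ▸ hrun.evaluation j)
    wlog hlt : i < j generalizing i j
    · exact this j i hij.symm hσ.symm heq.symm (hij.symm.lt_of_le (not_lt.1 hlt))
    exact ⟨i, (hmono i.le_succ).antisymm ((hmono (Nat.succ_le_of_lt hlt)).trans heq.ge)⟩
  have hfixed : safetyBellmanOp f h γh (Qh i) = Qh i := by
    rw [← (hrun.improvement i).safetyPolicyOp_eq, hi]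
    exact hrun.evaluation (i + 1)
  have hQi : Qh i = Qs := (isDiscounting_safetyBellmanOp h0).fixed_unique h1 hfixed hQs
  filter_upwards [eventually_ge_atTop i] with k hk
  exact (hrun.le_fixed h0 h1 hQs k).antisymm (hQi ▸ hmono hk)

end IsSafetyIteration

end SafetyIteration

section Reachability

open Relation

lemma exists_seq_of_reflTransGen {α : Type*} {R : α → α → Prop} (hR : ∀ i, ∃ j, R i j) {i j : α}
    (hij : ReflTransGen R i j) :
    ∃ τ : ℕ → α, τ 0 = i ∧ (∀ t, R (τ t) (τ (t + 1))) ∧ ∃ t, τ t = j := by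
  induction hij using ReflTransGen.head_induction_on with
  | refl =>
    choose next hnext using hR
    refine ⟨fun t => next^[t] j, rfl, fun t => ?_, 0, rfl⟩
    simpa only [Function.iterate_succ_apply'] using hnext _
  | head hstep _ ih =>
    rename_i i₀ i₁ _
    obtain ⟨τ, hτ0, hτ, t, ht⟩ := ih
    refine ⟨Nat.rec i₀ fun t _ => τ t, rfl, Nat.rec ?_ fun t _ => hτ t, t + 1, ht⟩
    change R i₀ (τ 0)
    rwa [hτ0]

lemma reflTransGen_of_seq {α : Type*} {R : α → α → Prop} {τ : ℕ → α}
    (hτ : ∀ t, R (τ t) (τ (t + 1))) (t : ℕ) : ReflTransGen R (τ 0) (τ t) :=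
  Nat.rec .refl (fun t ht => ht.tail (hτ t)) t

variable {X U A : Type*}

lemma trajSafety_mem_range [Finite X] (h : X → ℝ) (τ : ℕ → X × U × A) :
    trajSafety h τ ∈ Set.range h :=
  iInf_mem_of_finite (Set.finite_range h) fun t => ⟨(τ t).1, rfl⟩

variable [Fintype U] {f : X → U → A → X} {h : X → ℝ} {π : Policy X U}

/-- One step of play when the protagonist follows `π` and the adversary is unrestricted. -/
def Step (f : X → U → A → X) (π : Policy X U) (i j : X × U × A) : Prop :=
  j.1 = f i.1 i.2.1 i.2.2 ∧ 0 < π j.1 j.2.1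

lemma exists_step [Nonempty A] (f : X → U → A → X) (π : Policy X U) (i : X × U × A) :
    ∃ j, Step f π i j := by
  obtain ⟨u, hu⟩ := exists_pos (π (f i.1 i.2.1 i.2.2))
  exact ⟨(_, u, Classical.arbitrary A), rfl, hu⟩

variable [Fintype A]

instance nonempty_trajectory (f : X → U → A → X) (π : Policy X U) (μ : Policy X A)
    (x : X) (u : U) (a : A) : Nonempty {τ // IsTrajectory f π μ x u a τ} := by
  obtain ⟨τ, hτ0, hτ, -⟩ := exists_seq_of_reflTransGen
    (R := fun i j => j.1 = f i.1 i.2.1 i.2.2 ∧ 0 < π j.1 j.2.1 ∧ 0 < μ j.1 j.2.2)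
    (fun i => by
      obtain ⟨u', hu'⟩ := exists_pos (π (f i.1 i.2.1 i.2.2))
      obtain ⟨a', ha'⟩ := exists_pos (μ (f i.1 i.2.1 i.2.2))
      exact ⟨(_, u', a'), rfl, hu', ha'⟩) (ReflTransGen.refl (a := (x, u, a)))
  exact ⟨τ, hτ0, hτ⟩

lemma pairSafety_mem_range [Finite X] (f : X → U → A → X) (h : X → ℝ) (π : Policy X U)
    (μ : Policy X A) (x : X) (u : U) (a : A) : pairSafety f h π μ x u a ∈ Set.range h :=
  iInf_mem_of_finite (Set.finite_range h) fun τ => trajSafety_mem_range h τ.1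

lemma policySafety_le_of_isTrajectory [Finite X] {μ : Policy X A} {x : X} {u : U} {a : A}
    {τ : ℕ → X × U × A} (hτ : IsTrajectory f π μ x u a τ) (t : ℕ) :
    policySafety f h π x u a ≤ h (τ t).1 :=
  calc policySafety f h π x u a ≤ pairSafety f h π μ x u a :=
        iInf_le_of_mem_finite (Set.finite_range h)
          (fun μ => pairSafety_mem_range f h π μ x u a) μ
    _ ≤ trajSafety h τ :=
        iInf_le_of_mem_finite (Set.finite_range h)
          (p := fun τ : {τ // IsTrajectory f π μ x u a τ} => trajSafety h τ.1)
          (fun τ => trajSafety_mem_range h τ.1) ⟨τ, hτ⟩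
    _ ≤ h (τ t).1 :=
        iInf_le_of_mem_finite (Set.finite_range h) (fun t => ⟨(τ t).1, rfl⟩) t

variable [Nonempty A]

lemma isTrajectory_barycenter {τ : ℕ → X × U × A} (hτ : ∀ t, Step f π (τ t) (τ (t + 1))) :
    IsTrajectory f π (fun _ => stdSimplex.barycenter) (τ 0).1 (τ 0).2.1 (τ 0).2.2 τ :=
  ⟨rfl, fun t => ⟨(hτ t).1, (hτ t).2, barycenter_pos _⟩⟩

variable [Finite X]

lemma policySafety_mem_range (f : X → U → A → X) (h : X → ℝ) (π : Policy X U)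
    (x : X) (u : U) (a : A) : policySafety f h π x u a ∈ Set.range h :=
  iInf_mem_of_finite (Set.finite_range h) fun μ => pairSafety_mem_range f h π μ x u a

lemma stateSafety_mem_range [Nonempty U] (f : X → U → A → X) (h : X → ℝ) (π : Policy X U) (x : X) :
    stateSafety f h π x ∈ Set.range h := by
  obtain ⟨u, hu⟩ := exists_eq_ciSup_of_finite (f := fun u => ⨅ a, policySafety f h π x u a)
  rw [stateSafety, ← hu]
  exact iInf_mem_of_finite (Set.finite_range h) fun a => policySafety_mem_range f h π x u a

lemma le_policySafety_iff {c : ℝ} {x : X} {u : U} {a : A} :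
    c ≤ policySafety f h π x u a ↔ ∀ j, ReflTransGen (Step f π) (x, u, a) j → c ≤ h j.1 := by
  refine ⟨fun hc j hj => ?_, fun hreach => le_ciInf fun μ => ?_⟩
  · obtain ⟨τ, hτ0, hτ, t, rfl⟩ := exists_seq_of_reflTransGen (exists_step f π) hj
    have hτ' := isTrajectory_barycenter hτ
    rw [hτ0] at hτ'
    exact hc.trans (policySafety_le_of_isTrajectory hτ' t)
  · refine le_ciInf fun τ => le_ciInf fun t => hreach _ ?_
    rw [← τ.2.1]
    exact reflTransGen_of_seq (fun t => ⟨(τ.2.2 t).1, (τ.2.2 t).2.1⟩) t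

lemma le_policySafety_of_closed {c : ℝ} {G : Set (X × U × A)} (hG : ∀ i ∈ G, c ≤ h i.1)
    (hstep : ∀ i ∈ G, ∀ j, Step f π i j → j ∈ G) {x : X} {u : U} {a : A} (hx : (x, u, a) ∈ G) :
    c ≤ policySafety f h π x u a :=
  le_policySafety_iff.2 fun j hj => hG j <| by
    induction hj with
    | refl => exact hx
    | tail _ hij ih => exact hstep _ ih _ hij

lemma policySafety_le_constraint (π : Policy X U) (x : X) (u : U) (a : A) :
    policySafety f h π x u a ≤ h x :=
  le_policySafety_iff.1 le_rfl _ .refl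

lemma policySafety_le_succ {x : X} {u : U} {a : A} {u' : U} (hu' : 0 < π (f x u a) u') (a' : A) :
    policySafety f h π x u a ≤ policySafety f h π (f x u a) u' a' :=
  le_policySafety_iff.2 fun j hj => le_policySafety_iff.1 le_rfl j (hj.head ⟨rfl, hu'⟩)

lemma policySafety_le_optimalSafety (π : Policy X U) : policySafety f h π ≤ optimalSafety f h :=
  fun x u a => le_ciSup (f := fun π => policySafety f h π x u a)
    ⟨h x, Set.forall_mem_range.2 fun π => policySafety_le_constraint π x u a⟩ π

variable [Nonempty U] {γh : ℝ} {Qs : ActionValue X U A}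

lemma policySafety_le_of_fixed (h0 : 0 ≤ γh) (h1 : γh < 1)
    (hQs : safetyBellmanOp f h γh Qs = Qs) (π : Policy X U) : policySafety f h π ≤ Qs := by
  refine (isDiscounting_safetyBellmanOp h0).le_of_sub_super h1 (fun x u a => ?_) hQs.le
  obtain ⟨u', hu'⟩ := exists_pos (π (f x u a))
  exact le_safetyBackup h0 h1.le (policySafety_le_constraint π x u a)
    (le_maximin_iff.2 ⟨u', policySafety_le_succ hu'⟩)

lemma optimalSafety_le_of_fixed (h0 : 0 ≤ γh) (h1 : γh < 1)
    (hQs : safetyBellmanOp f h γh Qs = Qs) : optimalSafety f h ≤ Qs := fun x u a =>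
  ciSup_le fun π => policySafety_le_of_fixed h0 h1 hQs π x u a

end Reachability

section VanishingDiscount

variable {X U A : Type*} {f : X → U → A → X} {h : X → ℝ} {γ γ' : ℝ} {Q : ActionValue X U A} {c : ℝ}

/-- The superlevel set of `Q` at level `c` can be maintained by the protagonist. -/
def IsViable (f : X → U → A → X) (Q : ActionValue X U A) (c : ℝ) : Prop :=
  ∀ x u a, c ≤ Q x u a → ∃ u', ∀ a', c ≤ Q (f x u a) u' a'

lemma safetyBellmanOp_anti (hγ : γ ≤ γ') (Q : ActionValue X U A) :
    safetyBellmanOp f h γ' Q ≤ safetyBellmanOp f h γ Q := by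
  intro x u a
  rw [safetyBellmanOp_apply, safetyBellmanOp_apply, safetyBackup, safetyBackup]
  linarith [mul_le_mul_of_nonneg_right hγ (sub_nonneg.2 (min_le_left (h x) (maximin Q (f x u a))))]

variable [Finite U] [Nonempty U] [Finite A] [Nonempty A]

lemma isViable_of_undiscounted_fixed (hQ : safetyBellmanOp f h 1 Q = Q) (c : ℝ) :
    IsViable f Q c := by
  intro x u a hc
  rw [← hQ, safetyBellmanOp_apply, safetyBackup, sub_self, zero_mul, zero_add, one_mul] at hc
  exact le_maximin_iff.1 (hc.trans (min_le_right _ _))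

lemma continuous_safetyBellmanOp (x : X) (u : U) (a : A) :
    Continuous fun i : ℝ × ActionValue X U A => safetyBellmanOp f h i.1 i.2 x u a := by
  have hmaximin : Continuous fun i : ℝ × ActionValue X U A => maximin i.2 (f x u a) :=
    continuous_iSup_of_finite fun u' => continuous_iInf_of_finite fun a' => by fun_prop
  simp only [safetyBellmanOp_apply, safetyBackup]
  fun_prop

variable [Finite X]

lemma const_le_of_fixed (h0 : 0 ≤ γ) (h1 : γ < 1) (hQ : safetyBellmanOp f h γ Q = Q)
    (hc : ∀ y, c ≤ h y) (x : X) (u : U) (a : A) : c ≤ Q x u a := by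
  refine (isDiscounting_safetyBellmanOp h0).le_of_sub_super (P := fun _ _ _ => c) h1
    (fun x u a => ?_) hQ.le x u a
  exact le_safetyBackup h0 h1.le (hc x)
    ((le_maximin_iff (Q := fun _ _ _ => c) (x := f x u a)).2
      ⟨Classical.arbitrary U, fun _ => le_rfl⟩)

variable {F : ℝ → ActionValue X U A} (hF : ∀ γ ∈ Set.Ioo 0 1, safetyBellmanOp f h γ (F γ) = F γ)
include hF

lemma antitoneOn_of_fixed : AntitoneOn F (Set.Ioo 0 1) := by
  intro γ hγ γ' hγ' hle
  refine (isDiscounting_safetyBellmanOp hγ.1.le).le_of_sub_super hγ.2 ?_ (hF γ hγ).le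
  exact (hF γ' hγ').ge.trans (safetyBellmanOp_anti hle _)

lemma exists_undiscounted_limit :
    ∃ Q, safetyBellmanOp f h 1 Q = Q ∧ (∀ γ ∈ Set.Ioo 0 1, Q ≤ F γ) ∧
      Tendsto F (𝓝[<] 1) (𝓝 Q) := by
  obtain ⟨L, hL⟩ := Finite.bddBelow_range h
  have hbdd : ∀ x u a, BddBelow ((fun γ => F γ x u a) '' Set.Ioo 0 1) := fun x u a =>
    ⟨L, Set.forall_mem_image.2 fun γ hγ =>
      const_le_of_fixed hγ.1.le hγ.2 (hF γ hγ) (fun y => hL ⟨y, rfl⟩) x u a⟩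
  let Q : ActionValue X U A := fun x u a => sInf ((fun γ => F γ x u a) '' Set.Ioo 0 1)
  have hlim : Tendsto F (𝓝[<] 1) (𝓝 Q) := by
    simp only [tendsto_pi_nhds]
    intro x u a
    refine AntitoneOn.tendsto_nhdsWithin_Ioo_left (f := fun γ => F γ x u a)
      ⟨1 / 2, by norm_num⟩ (fun γ hγ γ' hγ' hle => ?_) (hbdd x u a)
    exact antitoneOn_of_fixed hF hγ hγ' hle x u a
  have hfixed : safetyBellmanOp f h 1 Q = Q := by
    ext x u a
    have hT := (continuous_safetyBellmanOp (f := f) (h := h) x u a).continuousAt.tendsto.comp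
      ((tendsto_nhdsWithin_of_tendsto_nhds tendsto_id).prodMk_nhds hlim)
    refine tendsto_nhds_unique (hT.congr' ?_)
      (tendsto_pi_nhds.1 (tendsto_pi_nhds.1 (tendsto_pi_nhds.1 hlim x) u) a)
    filter_upwards [Ioo_mem_nhdsLT zero_lt_one] with γ hγ
    exact congrFun₃ (hF γ hγ) x u a
  exact ⟨Q, hfixed, fun γ hγ x u a => csInf_le (hbdd x u a) ⟨γ, hγ, rfl⟩, hlim⟩

-- Close to `1`, the superlevel set at level `c` is that of the undiscounted limit.
lemma eventually_isViable (c : ℝ) : ∀ᶠ γ in 𝓝[<] 1, IsViable f (F γ) c := by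
  obtain ⟨Q, hQ, hle, hlim⟩ := exists_undiscounted_limit hF
  have hlevel : ∀ᶠ γ in 𝓝[<] 1, ∀ x u a, c ≤ F γ x u a → c ≤ Q x u a := by
    simp only [eventually_all]
    intro x u a
    rcases le_or_gt c (Q x u a) with hc | hc
    · exact Eventually.of_forall fun _ _ => hc
    · have hlim' := tendsto_pi_nhds.1 (tendsto_pi_nhds.1 (tendsto_pi_nhds.1 hlim x) u) a
      exact (hlim'.eventually_lt_const hc).mono fun γ hγ hcγ => absurd hcγ hγ.not_ge
  filter_upwards [hlevel, Ioo_mem_nhdsLT zero_lt_one] with γ hγ hγ1 x u a hc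
  obtain ⟨u', hu'⟩ := isViable_of_undiscounted_fixed hQ c x u a (hγ x u a hc)
  exact ⟨u', fun a' => (hu' a').trans (hle γ hγ1 _ u' a')⟩

end VanishingDiscount

section SafetyCertificate

variable {X U A : Type*} [Fintype U] [Fintype A]

/-- What the optimality arguments need to know about a fixed point `Qs` of the discounted safety
operator once the discount factor is close enough to `1`. -/
structure IsSafetyCertificate (f : X → U → A → X) (h : X → ℝ) (Qs : ActionValue X U A) : Prop where
  le_constraint : ∀ x u a, Qs x u a ≤ h x
  optimalSafety_le : optimalSafety f h ≤ Qs
  viable_zero : IsViable f Qs 0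
  viable_constraint : ∀ y, IsViable f Qs (h y)

lemma exists_certificate_threshold [Finite X] [Nonempty U] [Nonempty A] (f : X → U → A → X)
    (h : X → ℝ) :
    ∃ γ₀ < 1, ∀ γh, 0 < γh → γh < 1 → γ₀ < γh → ∀ Qs, safetyBellmanOp f h γh Qs = Qs →
      IsSafetyCertificate f h Qs := by
  choose! F hF using fun γ (hγ : γ ∈ Set.Ioo (0 : ℝ) 1) =>
    (isDiscounting_safetyBellmanOp (f := f) (h := h) hγ.1.le).exists_fixed hγ.1.le hγ.2
  obtain ⟨γ₀, hγ₀, hviable⟩ := mem_nhdsLT_iff_exists_Ioo_subset.1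
    ((eventually_isViable hF 0).and (eventually_all.2 fun y => eventually_isViable hF (h y)))
  refine ⟨γ₀, hγ₀, fun γh h0 h1 hlt Qs hQs => ?_⟩
  obtain rfl : F γh = Qs :=
    (isDiscounting_safetyBellmanOp h0.le).fixed_unique h1 (hF γh ⟨h0, h1⟩) hQs
  obtain ⟨hzero, hconstraint⟩ := hviable ⟨hlt, h1⟩
  exact ⟨le_constraint_of_fixed h0.le hQs, optimalSafety_le_of_fixed h0.le h1 hQs, hzero,
    hconstraint⟩

end SafetyCertificate

section SafePolicies

variable {X U A : Type*} [Fintype U] {f : X → U → A → X} {h : X → ℝ}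
  {Q Qs : ActionValue X U A} {π : Policy X U}

/-- Policies that use only admissible actions of `Q` inside the robust set and copy a deterministic
policy that is greedy for `Q` outside. -/
def safePolicies (Q : ActionValue X U A) : Set (Policy X U) :=
  {π | π ∈ invariantPolicies Q ∧
    ∃ σ, IsSafetyImprovement Q σ ∧ ∀ x, x ∉ robustSet Q → π x (σ x) = 1}

variable [Nonempty U]

lemma invariantPolicies_eq_respecting (Q : ActionValue X U A) :
    invariantPolicies Q = respecting (admissible Q) := by
  ext π
  exact forall_congr' fun x => imp_congr_left mem_robustSet_iff_admissible_nonempty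

lemma isClosed_safePolicies [Finite X] (Q : ActionValue X U A) : IsClosed (safePolicies Q) := by
  have hunion : safePolicies Q = respecting (admissible Q) ∩
      ⋃ σ : {σ // IsSafetyImprovement Q σ},
        ⋂ x ∈ (robustSet Q)ᶜ, {π : Policy X U | π x (σ.1 x) = 1} := by
    ext π
    simp [safePolicies, invariantPolicies_eq_respecting]
  rw [hunion]
  refine (isClosed_respecting _).inter (isClosed_iUnion_of_finite fun σ => ?_)
  exact isClosed_biInter fun x _ => isClosed_eq
    ((continuous_stdSimplex_apply _).comp (continuous_apply x)) continuous_const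

section TaskImprovement

variable [Finite A] [Nonempty A]

lemma isTaskImprovement_iff {σ : X → U} :
    IsTaskImprovement Q Qs σ π ↔
      IsGreedy (admissible Qs) Q π ∧ ∀ x, x ∉ robustSet Qs → π x (σ x) = 1 := by
  refine and_congr_left fun _ => forall_congr' fun x => ?_
  rw [mem_robustSet_iff_admissible_nonempty]
  refine forall_congr' fun hx => and_congr_right fun hcarried => ?_
  obtain ⟨ρ, hρ, hmax⟩ := exists_gameValue_eq_constrainedValue Q hx
  refine ⟨fun hbest => (gameValue_le_constrainedValue Q hcarried).antisymm ?_,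
    fun heq ρ' hρ' => (gameValue_le_constrainedValue Q hρ').trans heq.ge⟩
  exact hmax.ge.trans (hbest ρ hρ)

lemma exists_isTaskImprovement (Q Qs : ActionValue X U A) (σ : X → U) :
    ∃ π, IsTaskImprovement Q Qs σ π := by
  classical
  obtain ⟨π, hπ⟩ := exists_isGreedy (admissible Qs) Q
  refine ⟨fun x => if x ∈ robustSet Qs then π x else stdSimplex.vertex (σ x),
    isTaskImprovement_iff.2 ⟨fun x hx => ?_, fun x hx => by simp [hx]⟩⟩
  simpa only [if_pos (mem_robustSet_iff_admissible_nonempty.2 hx)] using hπ x hx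

lemma IsTaskImprovement.mem_safePolicies {σ : X → U}
    (hπ : IsTaskImprovement Q Qs σ π) (hσ : IsSafetyImprovement Qs σ) : π ∈ safePolicies Qs := by
  obtain ⟨hgreedy, hout⟩ := isTaskImprovement_iff.1 hπ
  exact ⟨invariantPolicies_eq_respecting Qs ▸ hgreedy.mem_respecting, σ, hσ, hout⟩

/-- Safe policies that solve, at every state of the robust set of `Qs`, the one-shot game whose
payoff is the optimal value `Qo` of the Markov game constrained to the admissible actions. -/
def optimalPolicies (Qs Qo : ActionValue X U A) : Set (Policy X U) :=
  {π | π ∈ safePolicies Qs ∧ IsGreedy (admissible Qs) Qo π}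

lemma optimalPolicies_nonempty (Qs Qo : ActionValue X U A) : (optimalPolicies Qs Qo).Nonempty := by
  obtain ⟨σ, hσ⟩ := exists_isSafetyImprovement Qs
  obtain ⟨π, hπ⟩ := exists_isTaskImprovement Qo Qs σ
  exact ⟨π, hπ.mem_safePolicies hσ, (isTaskImprovement_iff.1 hπ).1⟩

end TaskImprovement

namespace IsSafetyCertificate

variable [Fintype A] [Nonempty A] (hQs : IsSafetyCertificate f h Qs)
include hQs

lemma isInvariantConstraint : IsInvariantConstraint f (admissible Qs) := fun x u hu a =>
  mem_robustSet_iff_admissible_nonempty.1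
    (mem_robustSet_iff.2 (hQs.viable_zero x u a (mem_admissible_iff.1 hu a)))

variable [Finite X]

lemma le_policySafety {c : ℝ} (hc : c ≤ 0) (hviable : IsViable f Qs c) (hπ : π ∈ safePolicies Qs)
    {x : X} {u : U} {a : A} (hx : c ≤ Qs x u a) : c ≤ policySafety f h π x u a := by
  obtain ⟨hinv, σ, hσ, hout⟩ := hπ
  refine le_policySafety_of_closed (G := {i | c ≤ Qs i.1 i.2.1 i.2.2})
    (fun i hi => hi.trans (hQs.le_constraint _ _ _)) ?_ hx
  rintro ⟨x, u, a⟩ hi ⟨_, u', a'⟩ ⟨rfl, hu'⟩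
  by_cases hrobust : f x u a ∈ robustSet Qs
  · exact hc.trans (mem_admissible_iff.1 (mem_carriedBy_iff.1 (hinv _ hrobust) u' hu') a')
  · obtain rfl := eq_of_apply_eq_one_of_pos (hout _ hrobust) hu'
    have hmaximin : c ≤ maximin Qs (f x u a) := le_maximin_iff.2 (hviable x u a hi)
    rw [← hσ.iInf_eq] at hmaximin
    exact le_iInf_iff_of_finite.1 hmaximin a'

lemma stateSafety_le (hπ : π ∈ safePolicies Qs) {x : X} (hx : x ∉ robustSet Qs)
    (π' : Policy X U) : stateSafety f h π' x ≤ stateSafety f h π x := by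
  obtain ⟨y, hy⟩ := stateSafety_mem_range f h π' x
  obtain ⟨u, hu⟩ := le_maximin_iff.1 (le_refl (stateSafety f h π' x))
  have hle : ∀ a, stateSafety f h π' x ≤ Qs x u a := fun a =>
    (hu a).trans ((policySafety_le_optimalSafety π' x u a).trans (hQs.optimalSafety_le x u a))
  have hneg : stateSafety f h π' x ≤ 0 :=
    le_of_not_ge fun hpos => hx (mem_robustSet_iff.2 ⟨u, fun a => hpos.trans (hle a)⟩)
  exact le_maximin_iff.2
    ⟨u, fun a => hQs.le_policySafety hneg (hy ▸ hQs.viable_constraint y) hπ (hle a)⟩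

lemma nonneg_iff (x : X) (u : U) (a : A) : 0 ≤ Qs x u a ↔ 0 ≤ optimalSafety f h x u a := by
  refine ⟨fun hx => ?_, fun hx => hx.trans (hQs.optimalSafety_le x u a)⟩
  obtain ⟨σ, hσ⟩ := exists_isSafetyImprovement Qs
  obtain ⟨π, hπ⟩ := exists_isTaskImprovement Qs Qs σ
  exact (hQs.le_policySafety le_rfl hQs.viable_zero (hπ.mem_safePolicies hσ) hx).trans
    (policySafety_le_optimalSafety π x u a)

lemma admissible_eq (x : X) : admissible Qs x = admissible (optimalSafety f h) x :=
  Set.ext fun u => by simp only [mem_admissible_iff, hQs.nonneg_iff]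

lemma robustSet_eq : robustSet Qs = robustSet (optimalSafety f h) :=
  Set.ext fun x => by simp only [mem_robustSet_iff, hQs.nonneg_iff]

end IsSafetyCertificate

end SafePolicies

section Feasibility

variable {X U A : Type*} [Fintype X] [Fintype U] {f : X → U → A → X} {d : stdSimplex ℝ X}
  {Qs : ActionValue X U A} {π : Policy X U}

open Relation

lemma feasible_of_mem_invariantPolicies (d : stdSimplex ℝ X) (hπ : π ∈ invariantPolicies Qs) :
    Feasible f d Qs π :=
  fun τ _ _ hpos t ht => mem_carriedBy_iff.1 (hπ (τ t).1 ht) _ (hpos t)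

lemma Feasible.mem_admissible [Nonempty A] (hπ : Feasible f d Qs π) {i j : X × U × A}
    (hd : 0 < d i.1) (hi : 0 < π i.1 i.2.1) (hij : ReflTransGen (Step f π) i j)
    (hj : j.1 ∈ robustSet Qs) : j.2.1 ∈ admissible Qs j.1 := by
  obtain ⟨τ, rfl, hτ, t, rfl⟩ := exists_seq_of_reflTransGen (exists_step f π) hij
  exact hπ τ hd (fun t => (hτ t).1) (Nat.rec hi fun t _ => (hτ t).2) t hj

variable [Nonempty U] [Fintype A] [Nonempty A]

-- A feasible policy need not be admissible at the states that it never visits, hence the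
-- restriction to the pairs reachable from the support of `d`.
lemma Feasible.stateValue_le {r : ActionValue X U A} {γ : ℝ} {Qo : ActionValue X U A}
    (hπ : Feasible f d Qs π) (hC : IsInvariantConstraint f (admissible Qs)) (h0 : 0 ≤ γ)
    (h1 : γ < 1) (hQo : constrainedOp f r γ (admissible Qs) Qo = Qo) {x : X} (hd : 0 < d x)
    (hx : x ∈ robustSet Qs) : stateValue f r γ π x ≤ constrainedValue (admissible Qs) Qo x := by
  let D : Set (X × U) := {p | p.1 ∈ robustSet Qs ∧ ∀ a, ∃ i : X × U × A,
    0 < d i.1 ∧ 0 < π i.1 i.2.1 ∧ ReflTransGen (Step f π) i (p.1, p.2, a)}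
  have hDC : D ⊆ constraintGraph (admissible Qs) := fun p ⟨hp, hreach⟩ =>
    have ⟨_, hdi, hi, hip⟩ := hreach (Classical.arbitrary A)
    hπ.mem_admissible hdi hi hip hp
  have hclosed : IsPlayClosed f π D := by
    refine fun y u hyu a u' hu' => ⟨?_, fun a' => ?_⟩
    · exact mem_robustSet_iff_admissible_nonempty.2 (hC y u (hDC hyu) a)
    · obtain ⟨i, hdi, hi, hip⟩ := hyu.2 a
      exact ⟨i, hdi, hi, hip.tail ⟨rfl, hu'⟩⟩
  have hstart : ∀ u, 0 < π x u → (x, u) ∈ D := fun u hu => ⟨hx, fun a => ⟨_, hd, hu, .refl⟩⟩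
  exact (stateValue_le_gameValue_of_isPlayClosed h0 h1 hQo hclosed hDC hstart).trans
    (gameValue_le_constrainedValue Qo (mem_carriedBy_iff.2 fun u hu => hDC (hstart u hu)))

end Feasibility

section TwofoldProblem

lemma tendsto_infDist_of_forall_mapClusterPt {α β : Type*} [PseudoMetricSpace α] [CompactSpace α]
    {l : Filter β} {g : β → α} {s : Set α} (hs : ∀ a, MapClusterPt a l g → a ∈ s) :
    Tendsto (fun b => Metric.infDist (g b) s) l (𝓝 0) := by
  refine Metric.tendsto_nhds.2 fun ε hε => ?_
  by_contra hfar
  obtain ⟨a, ha, hcluster⟩ := IsCompact.exists_mapClusterPt_of_frequently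
    (s := {a | ε ≤ Metric.infDist a s})
    (isClosed_le continuous_const (Metric.continuous_infDist_pt s)).isCompact
    ((not_eventually.1 hfar).mono fun b hb => by
      simpa [abs_of_nonneg Metric.infDist_nonneg] using hb)
  have hzero : Metric.infDist a s = 0 := Metric.infDist_zero_of_mem (hs a hcluster)
  exact hε.not_ge (hzero ▸ ha)

variable {X U A : Type*} [Fintype X] [Fintype U] [Fintype A] {f : X → U → A → X} {h : X → ℝ}
  {r : ActionValue X U A} {γ : ℝ} {d : stdSimplex ℝ X} {Qs Qo : ActionValue X U A}

lemma objective_le_objective {π π' : Policy X U}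
    (hin : ∀ x ∈ robustSet Qs, 0 < d x → stateValue f r γ π x ≤ stateValue f r γ π' x)
    (hout : ∀ x ∉ robustSet Qs, stateSafety f h π x ≤ stateSafety f h π' x) :
    objective f h r γ d Qs π ≤ objective f h r γ d Qs π' := by
  refine (sum_le_sum_add (c := 0) d fun x hd => ?_).trans (add_zero _).le
  by_cases hx : x ∈ robustSet Qs
  · simpa [hx] using hin x hx hd
  · simpa [hx] using hout x hx

variable [Nonempty U] [Nonempty A]

namespace IsSafetyCertificate

variable (hQs : IsSafetyCertificate f h Qs) (h0 : 0 ≤ γ) (h1 : γ < 1)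
  (hQo : constrainedOp f r γ (admissible Qs) Qo = Qo)
include hQs h0 h1 hQo

lemma optimalPolicies_subset_solutions (d : stdSimplex ℝ X) :
    optimalPolicies Qs Qo ⊆ solutions f h r γ d Qs := by
  rintro π ⟨hsafe, hgreedy⟩
  refine ⟨feasible_of_mem_invariantPolicies d hsafe.1, fun π' hπ' =>
    objective_le_objective (fun x hx hd => ?_) fun x hx => hQs.stateSafety_le hsafe hx π'⟩
  rw [hgreedy.stateValue_eq hQs.isInvariantConstraint h0 h1 hQo
    (mem_robustSet_iff_admissible_nonempty.1 hx)]
  exact hπ'.stateValue_le hQs.isInvariantConstraint h0 h1 hQo hd hx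

variable {π : ℕ → Policy X U} (hsafe : ∀ᶠ j in atTop, π j ∈ safePolicies Qs)
include hsafe

lemma tendsto_objective
    (hvalue : ∀ x ∈ robustSet Qs, Tendsto (fun j => stateValue f r γ (π j) x) atTop
      (𝓝 (constrainedValue (admissible Qs) Qo x)))
    {p : Policy X U} (hp : p ∈ solutions f h r γ d Qs) :
    Tendsto (fun j => objective f h r γ d Qs (π j)) atTop (𝓝 (objective f h r γ d Qs p)) := by
  obtain ⟨q, hq⟩ := optimalPolicies_nonempty Qs Qo
  have hq_sol := hQs.optimalPolicies_subset_solutions h0 h1 hQo d hq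
  rw [(hq_sol.2 p hp.1).antisymm (hp.2 q hq_sol.1)]
  refine tendsto_finsetSum _ fun x _ => Tendsto.const_mul _ ?_
  by_cases hx : x ∈ robustSet Qs
  · have hlim := hvalue x hx
    rw [← hq.2.stateValue_eq hQs.isInvariantConstraint h0 h1 hQo
      (mem_robustSet_iff_admissible_nonempty.1 hx)] at hlim
    simpa [hx] using hlim
  · refine tendsto_const_nhds.congr' (hsafe.mono fun j hj => ?_)
    simpa [hx] using
      (hQs.stateSafety_le hj hx q).antisymm (hQs.stateSafety_le hq.1 hx (π j))

lemma tendsto_infDist_solutions (d : stdSimplex ℝ X)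
    (hgame : ∀ x ∈ robustSet Qs, Tendsto (fun j => gameValue Qo (π j x) x) atTop
      (𝓝 (constrainedValue (admissible Qs) Qo x))) :
    Tendsto (fun j => Metric.infDist (π j) (solutions f h r γ d Qs)) atTop (𝓝 0) := by
  refine tendsto_infDist_of_forall_mapClusterPt fun p hp =>
    hQs.optimalPolicies_subset_solutions h0 h1 hQo d ?_
  obtain ⟨F, hF, hFp⟩ := mapClusterPt_iff_ultrafilter.1 hp
  have hp_safe : p ∈ safePolicies Qs :=
    (isClosed_safePolicies Qs).mem_of_tendsto hFp (hF hsafe)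
  have hp_respecting : p ∈ respecting (admissible Qs) := by
    rw [← invariantPolicies_eq_respecting]
    exact hp_safe.1
  refine ⟨hp_safe, fun x hx => ⟨hp_respecting x hx, ?_⟩⟩
  have hcont : Continuous fun q : Policy X U => gameValue Qo (q x) x :=
    (continuous_gameValue Qo x).comp (continuous_apply x)
  have hlim : Tendsto (fun j => gameValue Qo (π j x) x) F (𝓝 (gameValue Qo (p x) x)) :=
    (hcont.tendsto p).comp hFp
  exact tendsto_nhds_unique hlim
    ((hgame x (mem_robustSet_iff_admissible_nonempty.2 hx)).mono_left hF)

end IsSafetyCertificate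

lemma IsSafetyCertificate.solutions_nonempty (hQs : IsSafetyCertificate f h Qs)
    (r : ActionValue X U A) (h0 : 0 ≤ γ) (h1 : γ < 1) (d : stdSimplex ℝ X) :
    (solutions f h r γ d Qs).Nonempty := by
  obtain ⟨Qo, hQo⟩ :=
    (isDiscounting_constrainedOp (f := f) (r := r) h0 (admissible Qs)).exists_fixed h0 h1
  exact (optimalPolicies_nonempty Qs Qo).mono
    (hQs.optimalPolicies_subset_solutions h0 h1 hQo d)

end TwofoldProblem

section Runs

variable {X U A : Type*} [Fintype U] {f : X → U → A → X} {h : X → ℝ} {r : ActionValue X U A}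
  {γ γh : ℝ} {n : ℕ} {π₀ : Policy X U} {σ₀ : X → U} {Qs : ActionValue X U A}

lemma IsRun.isSafetyIteration {π : ℕ → Policy X U} {Q : ℕ → ActionValue X U A} {σ : ℕ → X → U}
    {Qh : ℕ → ActionValue X U A} {K : ℕ} (hrun : IsRun f h r γh γ n π₀ σ₀ π Q σ Qh K) :
    IsSafetyIteration f h γh σ Qh :=
  ⟨hrun.safety_evaluation, hrun.safety_improvement⟩

variable [Finite X] [Finite A] [Nonempty U] [Nonempty A]

lemma exists_isRun (h0 : 0 ≤ γ) (h1 : γ < 1) (hh0 : 0 ≤ γh) (hh1 : γh < 1)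
    (hQs : safetyBellmanOp f h γh Qs = Qs) (hne : (robustSet Qs).Nonempty) (hn : 1 ≤ n)
    (π₀ : Policy X U) (σ₀ : X → U) :
    ∃ π Q σ Qh K, IsRun f h r γh γ n π₀ σ₀ π Q σ Qh K := by
  classical
  obtain ⟨σ, Qh, hσ₀, hsafety⟩ :=
    exists_isSafetyIteration (A := A) (f := f) (h := h) hh0 hh1 σ₀
  have hK : ∃ K, 1 ≤ K ∧ (robustSet (Qh (K * n))).Nonempty := by
    obtain ⟨K, hK, hK1⟩ := ((tendsto_id.atTop_mul_const' (Nat.lt_of_succ_le hn)).eventually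
      (hsafety.eventually_eq hh0 hh1 hQs)).and (eventually_ge_atTop 1) |>.exists
    exact ⟨K, hK1, by rwa [show Qh (K * n) = Qs from hK]⟩
  choose evaluate hevaluate using fun π : Policy X U =>
    (isDiscounting_performanceOp (f := f) (r := r) h0 π).exists_fixed h0 h1
  choose improve himprove using exists_isTaskImprovement (X := X) (U := U) (A := A)
  let K := Nat.find hK
  let π : ℕ → Policy X U := Nat.rec π₀ fun j p =>
    improve (evaluate p) (Qh ((K + j) * n)) (σ ((K + j) * n))
  refine ⟨π, fun j => evaluate (π j), σ, Qh, K, rfl, hσ₀, hsafety.evaluation, hsafety.improvement,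
    (Nat.find_spec hK).1, (Nat.find_spec hK).2, fun i hi hiK => ?_, fun j => hevaluate _,
    fun j => himprove _ _ _⟩
  exact Set.not_nonempty_iff_eq_empty.1 fun hi' => Nat.find_min hK hiK ⟨hi, hi'⟩

namespace IsRun

variable {π : ℕ → Policy X U} {Q : ℕ → ActionValue X U A} {σ : ℕ → X → U}
  {Qh : ℕ → ActionValue X U A} {K : ℕ} (hrun : IsRun f h r γh γ n π₀ σ₀ π Q σ Qh K)
include hrun

variable (hh0 : 0 ≤ γh) (hh1 : γh < 1) (hQs : safetyBellmanOp f h γh Qs = Qs) (hn : 1 ≤ n)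
include hh0 hh1 hQs hn

lemma eventually_isTaskImprovement :
    ∀ᶠ j in atTop, Qh ((K + j) * n) = Qs ∧ IsSafetyImprovement Qs (σ ((K + j) * n)) ∧
      IsTaskImprovement (Q j) Qs (σ ((K + j) * n)) (π (j + 1)) := by
  obtain ⟨N, hN⟩ :=
    eventually_atTop.1 (hrun.isSafetyIteration.eventually_eq hh0 hh1 hQs)
  filter_upwards [eventually_ge_atTop (N + 1)] with j hj
  obtain ⟨k, hk⟩ : ∃ k, (K + j) * n = N + k + 1 :=
    ⟨(K + j) * n - (N + 1), by have : K + j ≤ (K + j) * n := Nat.le_mul_of_pos_right _ hn; omega⟩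
  have hQh : Qh ((K + j) * n) = Qs := hN _ (by omega)
  refine ⟨hQh, ?_, hQh ▸ hrun.task_improvement j⟩
  rw [hk, ← hN (N + k) (by omega)]
  exact hrun.safety_improvement _

lemma eventually_mem_safePolicies : ∀ᶠ j in atTop, π j ∈ safePolicies Qs := by
  obtain ⟨J, hJ⟩ := eventually_atTop.1 (hrun.eventually_isTaskImprovement hh0 hh1 hQs hn)
  refine eventually_atTop.2 ⟨J + 1, fun j hj => ?_⟩
  obtain ⟨j, rfl⟩ := Nat.exists_eq_add_of_le' (le_of_add_le_right hj)
  exact (hJ j (by omega)).2.2.mem_safePolicies (hJ j (by omega)).2.1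

lemma exists_isConstrainedPolicyIteration :
    ∃ J, IsConstrainedPolicyIteration f r γ (admissible Qs) (fun j => π (j + J))
      fun j => Q (j + J) := by
  obtain ⟨J, hJ⟩ := eventually_atTop.1 (hrun.eventually_isTaskImprovement hh0 hh1 hQs hn)
  have hgreedy : ∀ j ≥ J, IsGreedy (admissible Qs) (Q j) (π (j + 1)) := fun j hj =>
    (isTaskImprovement_iff.1 (hJ j hj).2.2).1
  refine ⟨J + 1, ?_, fun j => hrun.task_evaluation _, fun j => ?_⟩
  · rw [zero_add]
    exact (hgreedy J le_rfl).mem_respecting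
  · rw [add_right_comm j 1]
    exact hgreedy _ (by omega)

end IsRun

end Runs

section RunsWithSafetyCertificate

variable {X U A : Type*} [Finite X] [Fintype U] [Fintype A] [Nonempty U] [Nonempty A]
  {f : X → U → A → X} {h : X → ℝ} {r : ActionValue X U A} {γ γh : ℝ} {n : ℕ}
  {π₀ : Policy X U} {σ₀ : X → U} {Qs Qo : ActionValue X U A} {π : ℕ → Policy X U}
  {Q : ℕ → ActionValue X U A} {σ : ℕ → X → U} {Qh : ℕ → ActionValue X U A} {K : ℕ}

namespace IsRun

variable (hrun : IsRun f h r γh γ n π₀ σ₀ π Q σ Qh K) (hh0 : 0 ≤ γh) (hh1 : γh < 1)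
  (hQs : safetyBellmanOp f h γh Qs = Qs) (hn : 1 ≤ n) (h0 : 0 ≤ γ) (h1 : γ < 1)
  (hcert : IsSafetyCertificate f h Qs)
include hrun hh0 hh1 hQs hn h0 h1 hcert

section OptimalValue

variable (hQo : constrainedOp f r γ (admissible Qs) Qo = Qo) {x : X} (hx : x ∈ robustSet Qs)
include hQo hx

lemma tendsto_stateValue :
    Tendsto (fun j => stateValue f r γ (π j) x) atTop
      (𝓝 (constrainedValue (admissible Qs) Qo x)) := by
  obtain ⟨J, hJ⟩ := hrun.exists_isConstrainedPolicyIteration hh0 hh1 hQs hn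
  exact (tendsto_add_atTop_iff_nat J).1 <|
    hJ.tendsto_stateValue h0 h1 hcert.isInvariantConstraint hQo
      (mem_robustSet_iff_admissible_nonempty.1 hx)

lemma tendsto_gameValue :
    Tendsto (fun j => gameValue Qo (π j x) x) atTop
      (𝓝 (constrainedValue (admissible Qs) Qo x)) := by
  obtain ⟨J, hJ⟩ := hrun.exists_isConstrainedPolicyIteration hh0 hh1 hQs hn
  exact (tendsto_add_atTop_iff_nat (f := fun j => gameValue Qo (π j x) x) J).1 <|
    hJ.tendsto_gameValue h0 h1 hcert.isInvariantConstraint hQo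
      (mem_robustSet_iff_admissible_nonempty.1 hx)

end OptimalValue

lemma exists_isGreatest_stateValue {x : X} (hx : x ∈ robustSet Qs) :
    ∃ v, IsGreatest ((fun p => stateValue f r γ p x) '' invariantPolicies Qs) v ∧
      Tendsto (fun j => stateValue f r γ (π j) x) atTop (𝓝 v) := by
  obtain ⟨Qo, hQo⟩ :=
    (isDiscounting_constrainedOp (f := f) (r := r) h0 (admissible Qs)).exists_fixed h0 h1
  refine ⟨_, ?_, hrun.tendsto_stateValue hh0 hh1 hQs hn h0 h1 hcert hQo hx⟩
  rw [invariantPolicies_eq_respecting]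
  exact isGreatest_stateValue hcert.isInvariantConstraint h0 h1 hQo
    (mem_robustSet_iff_admissible_nonempty.1 hx)

end IsRun

end RunsWithSafetyCertificate

section RunsOfTwofoldProblem

variable {X U A : Type*} [Fintype X] [Fintype U] [Fintype A] [Nonempty U] [Nonempty A]
  {f : X → U → A → X} {h : X → ℝ} {r : ActionValue X U A} {γ γh : ℝ} {n : ℕ}
  {π₀ : Policy X U} {σ₀ : X → U} {Qs : ActionValue X U A} {π : ℕ → Policy X U}
  {Q : ℕ → ActionValue X U A} {σ : ℕ → X → U} {Qh : ℕ → ActionValue X U A} {K : ℕ}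

namespace IsRun

variable (hrun : IsRun f h r γh γ n π₀ σ₀ π Q σ Qh K) (hh0 : 0 ≤ γh) (hh1 : γh < 1)
  (hQs : safetyBellmanOp f h γh Qs = Qs) (hn : 1 ≤ n) (h0 : 0 ≤ γ) (h1 : γ < 1)
  (hcert : IsSafetyCertificate f h Qs)
include hrun hh0 hh1 hQs hn h0 h1 hcert

lemma tendsto_objective {d : stdSimplex ℝ X} {p : Policy X U}
    (hp : p ∈ solutions f h r γ d Qs) :
    Tendsto (fun j => objective f h r γ d Qs (π j)) atTop (𝓝 (objective f h r γ d Qs p)) := by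
  obtain ⟨Qo, hQo⟩ :=
    (isDiscounting_constrainedOp (f := f) (r := r) h0 (admissible Qs)).exists_fixed h0 h1
  exact hcert.tendsto_objective h0 h1 hQo (hrun.eventually_mem_safePolicies hh0 hh1 hQs hn)
    (fun x hx => hrun.tendsto_stateValue hh0 hh1 hQs hn h0 h1 hcert hQo hx) hp

lemma tendsto_infDist_solutions (d : stdSimplex ℝ X) :
    Tendsto (fun j => Metric.infDist (π j) (solutions f h r γ d Qs)) atTop (𝓝 0) := by
  obtain ⟨Qo, hQo⟩ :=
    (isDiscounting_constrainedOp (f := f) (r := r) h0 (admissible Qs)).exists_fixed h0 h1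
  exact hcert.tendsto_infDist_solutions h0 h1 hQo
    (hrun.eventually_mem_safePolicies hh0 hh1 hQs hn) d
    fun x hx => hrun.tendsto_gameValue hh0 hh1 hQs hn h0 h1 hcert hQo hx

end IsRun

end RunsOfTwofoldProblem

end ConstrainedGame

theorem mainTheorem1 {X U A : Type*} [Fintype X] [Fintype U] [Fintype A] [Nonempty U] [Nonempty A]
    (f : X → U → A → X) (h : X → ℝ)
    (hsafe : (robustSet (optimalSafety f h)).Nonempty) :
    ∃ γ₀ : ℝ, γ₀ < 1 ∧ ∀ γh : ℝ, 0 < γh → γh < 1 →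
      ∃ Qs : ActionValue X U A,
        -- `Qs` is the unique fixed point of the safety Bellman operator
        (∀ Q, safetyBellmanOp f h γh Q = Q ↔ Q = Qs) ∧
        -- for `γh` close to `1` it yields the true maximal robust invariant set and actions
        (γ₀ < γh → robustSet Qs = robustSet (optimalSafety f h) ∧
          ∀ x, admissible Qs x = admissible (optimalSafety f h) x) ∧
        ∀ (r : ActionValue X U A) (γ : ℝ), 0 ≤ γ → γ < 1 → ∀ n : ℕ, 1 ≤ n →
        ∀ (π₀ : Policy X U) (σ₀ : X → U),
          -- the algorithm can be executed from any initial policies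
          (∃ π Q σ Qh K, IsRun f h r γh γ n π₀ σ₀ π Q σ Qh K) ∧
          ∀ π Q σ Qh K, IsRun f h r γh γ n π₀ σ₀ π Q σ Qh K →
            -- monotone convergence of the safety policy
            (∀ k, Qh k ≤ Qh (k + 1)) ∧
            (∀ k, Qh k ≤ Qs) ∧
            (∀ᶠ k in atTop, Qh k = Qs) ∧
            (∀ k, robustSet (Qh k) ⊆ robustSet (Qh (k + 1))) ∧
            (∀ᶠ k in atTop, robustSet (Qh k) = robustSet Qs) ∧
            (γ₀ < γh →
              -- the task policy becomes invariant, and copies a safety policy with value `Qs`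
              (∀ᶠ j in atTop, π j ∈ invariantPolicies Qs) ∧
              (∀ᶠ j in atTop, Qh ((K + j) * n) = Qs ∧
                ∀ x, x ∉ robustSet Qs → π (j + 1) x (σ ((K + j) * n) x) = 1) ∧
              -- inside: worst-case reward optimality among the invariant policies, in the limit
              (∀ x ∈ robustSet Qs, ∃ v : ℝ,
                IsGreatest ((fun p => stateValue f r γ p x) '' invariantPolicies Qs) v ∧
                Tendsto (fun j => stateValue f r γ (π j) x) atTop (𝓝 v)) ∧
              -- outside: maximal safety value among all policies
              (∀ᶠ j in atTop, ∀ x, x ∉ robustSet Qs →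
                ∀ p : Policy X U, stateSafety f h p x ≤ stateSafety f h (π j) x) ∧
              -- convergence to the solutions of the twofold problem
              ∀ d : stdSimplex ℝ X,
                (solutions f h r γ d Qs).Nonempty ∧
                (∀ᶠ j in atTop, Feasible f d Qs (π j)) ∧
                (∀ p ∈ solutions f h r γ d Qs,
                  Tendsto (fun j => objective f h r γ d Qs (π j)) atTop
                    (𝓝 (objective f h r γ d Qs p))) ∧
                Tendsto (fun j => Metric.infDist (π j) (solutions f h r γ d Qs)) atTop (𝓝 0)) := by
  obtain ⟨γ₀, hγ₀, hcertificate⟩ := exists_certificate_threshold f h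
  refine ⟨γ₀, hγ₀, fun γh hh0 hh1 => ?_⟩
  have hsafety := isDiscounting_safetyBellmanOp (f := f) (h := h) hh0.le
  obtain ⟨Qs, hQs⟩ := hsafety.exists_fixed hh0.le hh1
  have hne := hsafe.mono (robustSet_mono (optimalSafety_le_of_fixed hh0.le hh1 hQs))
  refine ⟨Qs, fun Q => ⟨fun hQ => hsafety.fixed_unique hh1 hQ hQs, fun hQ => hQ ▸ hQs⟩,
    fun hlt => have hcert := hcertificate γh hh0 hh1 hlt Qs hQs
      ⟨hcert.robustSet_eq, hcert.admissible_eq⟩,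
    fun r γ h0 h1 n hn π₀ σ₀ => ⟨exists_isRun h0 h1 hh0.le hh1 hQs hne hn π₀ σ₀,
      fun π Q σ Qh K hrun => ?_⟩⟩
  have hmono := hrun.isSafetyIteration.le_succ hh0.le hh1
  have hstable := hrun.isSafetyIteration.eventually_eq hh0.le hh1 hQs
  refine ⟨hmono, hrun.isSafetyIteration.le_fixed hh0.le hh1 hQs, hstable,
    fun k => robustSet_mono (hmono k), hstable.mono fun k hk => congrArg robustSet hk,
    fun hlt => ?_⟩
  have hcert := hcertificate γh hh0 hh1 hlt Qs hQs
  have hpolicies := hrun.eventually_mem_safePolicies hh0.le hh1 hQs hn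
  have htask := hrun.eventually_isTaskImprovement hh0.le hh1 hQs hn
  exact ⟨hpolicies.mono fun j hj => hj.1, htask.mono fun j hj => ⟨hj.1, hj.2.2.2⟩,
    fun x => hrun.exists_isGreatest_stateValue hh0.le hh1 hQs hn h0 h1 hcert,
    hpolicies.mono fun j hj x => hcert.stateSafety_le hj,
    fun d => ⟨hcert.solutions_nonempty r h0 h1 d,
      hpolicies.mono fun j hj => feasible_of_mem_invariantPolicies d hj.1,
      fun p => hrun.tendsto_objective hh0.le hh1 hQs hn h0 h1 hcert,
      hrun.tendsto_infDist_solutions hh0.le hh1 hQs hn h0 h1 hcert d⟩⟩
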